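/- For $n\ge 1$ choose a mapping $f:\{1,\dots,n\}\to\{1,\dots,n\}$ uniformly at random among all $n^n$ mappings. Its components are the connected components of the undirected graph on $\{1,\dots,n\}$ in which $i$ is joined to $f(i)$ for every $i$. Likewise, for $n\ge 3$ choose uniformly at random a $2$-regular labeled graph, i.e. a simple undirected graph on the vertex set $\{1,\dots,n\}$ in which every vertex has degree $2$. In either model let $\Lambda_n$ be the number of vertices of a largest component. A median of $\Lambda_n$ is a real number $m$ with $P(\Lambda_n\le m)\ge\frac12$ and $P(\Lambda_n\ge m)\ge\frac12$; such an $m$ exists for every $n$ considered. Then, in each of the two models: (i) for every choice of medians ${}_L\nu_n$ of $\Lambda_n$, $$\lim_{n\to\infty}\frac{{}_L\nu_n}{n}=\frac{4e}{(1+e)^2}=0.78644773296592741014\ldots;$$ (ii) for every $x\in[\frac12,1]$, $$\lim_{n\to\infty}P(\Lambda_n>xn)=\int_x^1\frac{dy}{2y\sqrt{1-y}}.$$ -/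

import Mathlib

namespace RandomStructures

/-- Probability of the event `p` for an element chosen uniformly from the finite type `α`. -/
noncomputable def uniformProb {α : Type*} (p : α → Prop) : ℝ :=
  (Nat.card {a : α // p a} : ℝ) / (Nat.card α : ℝ)

/-- `m` is a median of `X a`, where `a` is uniform on the finite type `α`. -/
def IsMedian {α : Type*} (X : α → ℕ) (m : ℝ) : Prop :=
  1 / 2 ≤ uniformProb (fun a => (X a : ℝ) ≤ m) ∧
    1 / 2 ≤ uniformProb (fun a => m ≤ (X a : ℝ))

/-- The number of vertices of a largest connected component of a finite graph
(`0` if there are no vertices). -/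
noncomputable def largestComponent {V : Type*} (G : SimpleGraph V) : ℕ :=
  ⨆ c : G.ConnectedComponent, c.supp.ncard

/-- Mappings of an `n`-element labeled set to itself. -/
abbrev Mapping (n : ℕ) : Type := Fin n → Fin n

/-- The underlying undirected graph of a mapping: `i` is joined to `f i` for every `i`.
Loops, which have no influence on connectedness, are dropped. -/
def Mapping.graph {n : ℕ} (f : Mapping n) : SimpleGraph (Fin n) :=
  SimpleGraph.fromRel (fun i j => f i = j)

/-- Size of the largest component of a mapping. -/
noncomputable def Mapping.largest {n : ℕ} (f : Mapping n) : ℕ :=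
  largestComponent (Mapping.graph f)

open Classical in
/-- Labeled simple undirected graphs on `n` vertices in which every vertex has degree `2`. -/
def TwoRegularGraph (n : ℕ) : Type :=
  {G : SimpleGraph (Fin n) // G.IsRegularOfDegree 2}

/-- Size of the largest component of a `2`-regular graph. -/
noncomputable def TwoRegularGraph.largest {n : ℕ} (G : TwoRegularGraph n) : ℕ :=
  largestComponent G.1

end RandomStructures

open Filter Topology Set MeasureTheory

namespace RandomStructures

/-! ### The limit constant -/

/-! Both models are labeled classes whose members are determined by their components. Let `t n` and
`c k` count all and connected structures, and put p_n = t_n/(n! ρ^n), q_k = c_k/(k! ρ^k). For x ≥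
1/2 at most one component has more than xn vertices, so choosing its vertex set gives P(Λ_n > xn) =
Σ_{k>xn} q_k p_{n-k}/p_n. If p_n √n → A > 0 and k q_k → 1/2, this is asymptotically a Riemann sum
for ∫_x^1 dy/(2y√(1-y)); A cancels, so both models share the limit (`tendsto_tail_sum`).

The connected counts come from n t_n = Σ_k C(n,k) k c_k t_{n-k}, obtained by weighting each
component with its size. For mappings, ρ = e, t_n = n^n, and Stirling gives the first hypothesis.
Abel's identity gives k c_k/k! = Σ_{m<k} k^m/m!, which is asymptotic to e^k/2 by a Gaussian limit of
birthday probabilities. For 2-regular graphs, ρ = 1. A connected one on k ≥ 3 vertices has exactly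
two orientations as a cyclic permutation, so k c_k/k! = 1/2, and the resulting recurrence for p_n
squeezes n p_n² to a positive limit.

With s = √(1-x) the limiting tail is ½ log((1+s)/(1-s)). It is strictly decreasing in x and equals
1/2 exactly when s = (e-1)/(e+1), that is x = 4e/(1+e)²; medians must concentrate there
(`tendsto_median`). -/

theorem limit_constant_bounds :
    0.78644773296592741014 ≤ 4 * Real.exp 1 / (1 + Real.exp 1) ^ 2 ∧
      4 * Real.exp 1 / (1 + Real.exp 1) ^ 2 < 0.78644773296592741015 := by
  -- With 26 Taylor terms the error is below 10⁻²⁶, enough for the 23 decimals of e used next.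
  have h := abs_sub_le_iff.1 (Real.exp_bound (x := 1) (by simp) (n := 26) (by norm_num))
  norm_num [Finset.sum_range_succ, Nat.factorial] at h
  obtain ⟨h1, h2⟩ := h
  have hl : (2.71828182845904523536028 : ℝ) < Real.exp 1 := by
    refine lt_of_lt_of_le ?_ (sub_le_iff_le_add'.2 h2)
    norm_num
  have hu : Real.exp 1 < (2.71828182845904523536029 : ℝ) := by
    refine lt_of_le_of_lt h1 ?_
    norm_num
  constructor
  · rw [le_div_iff₀ (by positivity)]
    nlinarith
  · rw [div_lt_iff₀ (by positivity)]
    nlinarith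

/-! ### The limiting tail integral -/

/-- The antiderivative is -artanh √(1-y). The integrand is singular at 1, but a nonnegative
derivative of a continuous function is integrable. -/
theorem integral_tail_eq {x : ℝ} (hx0 : 0 < x) (hx1 : x ≤ 1) :
    ∫ y in x..1, 1 / (2 * y * Real.sqrt (1 - y)) =
      (Real.log (1 + Real.sqrt (1 - x)) - Real.log (1 - Real.sqrt (1 - x))) / 2 := by
  set g : ℝ → ℝ := fun y =>
    -((Real.log (1 + Real.sqrt (1 - y)) - Real.log (1 - Real.sqrt (1 - y))) / 2) with hg
  have hlt : ∀ y, 0 < y → Real.sqrt (1 - y) < 1 := fun y hy => by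
    rw [Real.sqrt_lt' one_pos]; linarith
  have hcont : ContinuousOn g (Icc x 1) := by
    have h1 : ∀ y ∈ Icc x 1, 1 + Real.sqrt (1 - y) ≠ 0 := fun y _ => by positivity
    have h2 : ∀ y ∈ Icc x 1, 1 - Real.sqrt (1 - y) ≠ 0 := fun y hy => by
      have := hlt y (hx0.trans_le hy.1); linarith
    exact (((ContinuousOn.log (by fun_prop) h1).sub
      (ContinuousOn.log (by fun_prop) h2)).div_const 2).neg
  have hder : ∀ y ∈ Ioo x 1, HasDerivAt g (1 / (2 * y * Real.sqrt (1 - y))) y := by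
    intro y hy
    have hy0 : 0 < y := hx0.trans hy.1
    have hy1 : 0 < 1 - y := by linarith [hy.2]
    have hs : 0 < Real.sqrt (1 - y) := Real.sqrt_pos.2 hy1
    have hs1 := hlt y hy0
    have hsq : Real.sqrt (1 - y) ^ 2 = 1 - y := Real.sq_sqrt hy1.le
    have hd : HasDerivAt (fun y => Real.sqrt (1 - y)) (-1 / (2 * Real.sqrt (1 - y))) y :=
      ((hasDerivAt_id y).const_sub 1).sqrt hy1.ne'
    have h1 := (hd.const_add 1).log (by positivity)
    have h2 := (hd.const_sub 1).log (by linarith)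
    have h3 := ((h1.sub h2).div_const 2).neg
    convert! h3 using 1
    have hne : 1 - Real.sqrt (1 - y) ≠ 0 := by linarith
    have hyy : y = (1 - Real.sqrt (1 - y)) * (1 + Real.sqrt (1 - y)) := by linarith
    generalize Real.sqrt (1 - y) = s at *
    rw [hyy]
    field_simp
    ring
  have hpos : ∀ y ∈ Ioo x 1, 0 ≤ 1 / (2 * y * Real.sqrt (1 - y)) := fun y hy => by
    have := hx0.trans hy.1
    positivity
  have hintble : IntervalIntegrable (fun y => 1 / (2 * y * Real.sqrt (1 - y))) volume x 1 := by
    apply intervalIntegral.intervalIntegrable_deriv_of_nonneg (g := g)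
    · rwa [uIcc_of_le hx1]
    · simpa [hx1] using hder
    · simpa [hx1] using hpos
  rw [intervalIntegral.integral_eq_sub_of_hasDerivAt_of_le hx1 hcont hder hintble]
  simp [hg]

theorem integral_tail_strictAntiOn :
    StrictAntiOn (fun x : ℝ => ∫ y in x..1, 1 / (2 * y * Real.sqrt (1 - y))) (Ioc 0 1) := by
  intro x hx y hy hxy
  simp only
  rw [integral_tail_eq hx.1 hx.2, integral_tail_eq hy.1 hy.2]
  have h0 : Real.sqrt (1 - x) < 1 := by
    rw [Real.sqrt_lt' one_pos]; linarith [hx.1]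
  have h1 : Real.sqrt (1 - y) < Real.sqrt (1 - x) :=
    Real.sqrt_lt_sqrt (by linarith [hy.2]) (by linarith)
  have h2 := Real.log_lt_log (by positivity)
    (show 1 + Real.sqrt (1 - y) < 1 + Real.sqrt (1 - x) by linarith)
  have h3 := Real.log_lt_log (by linarith)
    (show 1 - Real.sqrt (1 - x) < 1 - Real.sqrt (1 - y) by linarith)
  linarith

theorem integral_tail_limit_constant :
    ∫ y in (4 * Real.exp 1 / (1 + Real.exp 1) ^ 2)..1, 1 / (2 * y * Real.sqrt (1 - y)) = 1 / 2 := by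
  have he := Real.exp_pos 1
  have he1 : 1 < Real.exp 1 := by simp
  have hs : Real.sqrt (1 - 4 * Real.exp 1 / (1 + Real.exp 1) ^ 2) =
      (Real.exp 1 - 1) / (1 + Real.exp 1) := by
    rw [Real.sqrt_eq_iff_mul_self_eq_of_pos (div_pos (by linarith) (by linarith))]
    field_simp
    ring
  have hnum : 1 + (Real.exp 1 - 1) / (1 + Real.exp 1) ≠ 0 := by
    have := div_pos (show 0 < Real.exp 1 - 1 by linarith) (show 0 < 1 + Real.exp 1 by linarith)
    linarith
  have hden : 1 - (Real.exp 1 - 1) / (1 + Real.exp 1) ≠ 0 := by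
    have : (Real.exp 1 - 1) / (1 + Real.exp 1) < 1 := by
      rw [div_lt_one (by linarith)]; linarith
    linarith
  rw [integral_tail_eq (by positivity) (by linarith [limit_constant_bounds.2]), hs,
    ← Real.log_div hnum hden]
  have : (1 + (Real.exp 1 - 1) / (1 + Real.exp 1)) / (1 - (Real.exp 1 - 1) / (1 + Real.exp 1)) =
      Real.exp 1 := by
    field_simp
    ring
  rw [this, Real.log_exp]

/-! ### Medians -/

theorem uniformProb_mono {α : Type*} [Finite α] {p q : α → Prop} (h : ∀ a, p a → q a) :
    uniformProb p ≤ uniformProb q := by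
  unfold uniformProb
  gcongr
  exact Nat.card_le_card_of_injective (Subtype.map id h) (Subtype.map_injective h fun _ _ h => h)

theorem uniformProb_add_not {α : Type*} [Finite α] [Nonempty α] (p : α → Prop) :
    uniformProb p + uniformProb (fun a => ¬ p a) = 1 := by
  classical
  have h : Nat.card {a // p a} + Nat.card {a // ¬ p a} = Nat.card α := by
    rw [← Nat.card_sum]
    exact Nat.card_congr (Equiv.sumCompl p)
  have h0 : (Nat.card α : ℝ) ≠ 0 := by exact_mod_cast Nat.card_pos.ne'
  unfold uniformProb
  rw [← add_div, div_eq_one_iff_eq h0]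
  exact_mod_cast h

theorem exists_isMedian {α : Type*} [Finite α] [Nonempty α] (X : α → ℕ) :
    ∃ m : ℝ, IsMedian X m := by
  classical
  have hone : ∃ k : ℕ, 1 / 2 ≤ uniformProb (fun a => (X a : ℝ) ≤ (k : ℝ)) := by
    obtain ⟨M, hM⟩ := (Set.finite_range X).bddAbove
    refine ⟨M, ?_⟩
    have h : uniformProb (fun a => (X a : ℝ) ≤ (M : ℝ)) = 1 := by
      have h1 := uniformProb_add_not (fun a => (X a : ℝ) ≤ (M : ℝ))
      have h2 : uniformProb (fun a => ¬ (X a : ℝ) ≤ (M : ℝ)) = 0 := by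
        have : IsEmpty {a // ¬ (X a : ℝ) ≤ (M : ℝ)} :=
          ⟨fun a => a.2 (by exact_mod_cast hM ⟨a.1, rfl⟩)⟩
        rw [uniformProb, Nat.card_of_isEmpty]; simp
      linarith
    rw [h]; norm_num
  -- The median is the least integer k with P(X ≤ k) ≥ 1/2; minimality gives P(X ≥ k) ≥ 1/2.
  refine ⟨Nat.find hone, Nat.find_spec hone, ?_⟩
  rcases Nat.eq_zero_or_pos (Nat.find hone) with h0 | hpos
  · rw [h0]
    refine (Nat.find_spec hone).trans (uniformProb_mono fun a _ => by simp)
  · have hlt := Nat.find_min hone (Nat.sub_lt hpos one_pos)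
    have h1 := uniformProb_add_not (fun a => (X a : ℝ) ≤ ((Nat.find hone - 1 : ℕ) : ℝ))
    have h2 : uniformProb (fun a => ¬ (X a : ℝ) ≤ ((Nat.find hone - 1 : ℕ) : ℝ)) ≤
        uniformProb (fun a => ((Nat.find hone : ℕ) : ℝ) ≤ (X a : ℝ)) := by
      refine uniformProb_mono fun a ha => ?_
      have ha' : ¬ X a ≤ Nat.find hone - 1 := by exact_mod_cast ha
      have : Nat.find hone ≤ X a := by omega
      exact_mod_cast this
    linarith

/-- The limiting tail crosses 1/2 strictly at x₀, which is interior to [1/2, 1]. So just below x₀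
the tail probability is eventually above 1/2, just above x₀ eventually below it, and this traps
every median. -/
theorem tendsto_median {α : ℕ → Type*} [∀ n, Finite (α n)] (X : ∀ n, α n → ℕ)
    (h : ∀ x : ℝ, x ∈ Icc (1 / 2 : ℝ) 1 →
      Tendsto (fun n : ℕ => uniformProb (fun a : α n => x * (n : ℝ) < (X n a : ℝ))) atTop
        (𝓝 (∫ y in x..1, 1 / (2 * y * Real.sqrt (1 - y)))))
    (ν : ℕ → ℝ) (hν : ∀ᶠ n : ℕ in atTop, IsMedian (X n) (ν n)) :
    Tendsto (fun n : ℕ => ν n / (n : ℝ)) atTop (𝓝 (4 * Real.exp 1 / (1 + Real.exp 1) ^ 2)) := by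
  obtain ⟨hb1, hb2⟩ := limit_constant_bounds
  set x₀ := 4 * Real.exp 1 / (1 + Real.exp 1) ^ 2 with hx₀
  have hI : ∫ y in x₀..1, 1 / (2 * y * Real.sqrt (1 - y)) = 1 / 2 := integral_tail_limit_constant
  have hmem : x₀ ∈ Ioc (0 : ℝ) 1 := ⟨by linarith, by linarith⟩
  refine tendsto_order.2 ⟨fun b hb => ?_, fun b hb => ?_⟩
  · obtain ⟨x, hx1, hx2⟩ := exists_between (max_lt hb (show 1 / 2 < x₀ by linarith))
    have hxb := (le_max_left _ _).trans_lt hx1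
    have hxh := (le_max_right _ _).trans_lt hx1
    have hF := integral_tail_strictAntiOn (a := x) ⟨by linarith, by linarith⟩ hmem hx2
    simp only [hI] at hF
    filter_upwards [hν, (h x ⟨hxh.le, by linarith⟩).eventually_const_lt hF, eventually_gt_atTop 0]
      with n hn hP hpos
    by_contra! hcon
    have hn0 : (0 : ℝ) < n := by exact_mod_cast hpos
    rw [div_le_iff₀ hn0] at hcon
    -- On an empty type every `uniformProb` is 0/0 = 0, which contradicts `hP`.
    have hne : Nonempty (α n) := by
      by_contra hemp
      rw [not_nonempty_iff] at hemp
      norm_num [uniformProb] at hP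
    have h1 := uniformProb_add_not (fun a : α n => x * (n : ℝ) < (X n a : ℝ))
    have h2 : uniformProb (fun a => (X n a : ℝ) ≤ ν n) ≤
        uniformProb (fun a : α n => ¬ x * (n : ℝ) < (X n a : ℝ)) :=
      uniformProb_mono fun a ha => by
        have : b * n ≤ x * n := by gcongr
        linarith
    linarith [hn.1]
  · obtain ⟨x, hx1, hx2⟩ := exists_between (lt_min hb (show x₀ < 1 by linarith))
    have hxb := hx2.trans_le (min_le_left _ _)
    have hxh := hx2.trans_le (min_le_right _ _)
    have hF := integral_tail_strictAntiOn hmem (b := x) ⟨by linarith, hxh.le⟩ hx1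
    simp only [hI] at hF
    filter_upwards [hν, (h x ⟨by linarith, hxh.le⟩).eventually_lt_const hF, eventually_gt_atTop 0]
      with n hn hP hpos
    by_contra! hcon
    have hn0 : (0 : ℝ) < n := by exact_mod_cast hpos
    rw [le_div_iff₀ hn0] at hcon
    have h2 : uniformProb (fun a => ν n ≤ (X n a : ℝ)) ≤
        uniformProb (fun a : α n => x * (n : ℝ) < (X n a : ℝ)) :=
      uniformProb_mono fun a ha => by
        have : x * n < b * n := by gcongr
        linarith
    linarith [hn.2]

/-! ### Sums as integrals of step functions -/

theorem measurable_comp_floor (H : ℕ → ℝ) (c : ℝ) : Measurable fun t : ℝ => H ⌊c * t⌋₊ :=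
  (measurable_from_top (f := H)).comp (Nat.measurable_floor.comp (measurable_const_mul c))

/-- Writing sums as integrals lets dominated convergence replace Riemann sum estimates, which the
singular limit integrand would complicate. -/
theorem integral_step (H : ℕ → ℝ) {c : ℝ} (hc : 0 < c) (N : ℕ) :
    ∫ t in (0 : ℝ)..(N / c), H ⌊c * t⌋₊ = (∑ j ∈ Finset.range N, H j) / c := by
  have hpiece : ∀ j : ℕ, EqOn (fun _ => H j) (fun t : ℝ => H ⌊c * t⌋₊)
      (Ioo ((j : ℝ) / c) (((j + 1 : ℕ) : ℝ) / c)) := by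
    intro j t ht
    have h1 : (j : ℝ) ≤ c * t := by
      have := (div_lt_iff₀' hc).1 ht.1; linarith
    have h2 : c * t < j + 1 := by
      have := (lt_div_iff₀' hc).1 ht.2; push_cast at this; linarith
    simp only
    rw [(Nat.floor_eq_iff (le_trans (by positivity) h1)).2 ⟨h1, h2⟩]
  have hle : ∀ j : ℕ, (j : ℝ) / c ≤ ((j + 1 : ℕ) : ℝ) / c := fun j => by
    gcongr; simp
  have hintble : ∀ j : ℕ, IntervalIntegrable (fun t : ℝ => H ⌊c * t⌋₊) volume
      ((j : ℝ) / c) (((j + 1 : ℕ) : ℝ) / c) := fun j => by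
    rw [intervalIntegrable_iff_integrableOn_Ioo_of_le (hle j)]
    exact (integrableOn_const (by simp)).congr_fun (hpiece j) measurableSet_Ioo
  have h := intervalIntegral.sum_integral_adjacent_intervals (f := fun t : ℝ => H ⌊c * t⌋₊)
    (μ := volume) (a := fun j : ℕ => (j : ℝ) / c) (n := N) (fun j _ => hintble j)
  simp only [Nat.cast_zero, zero_div] at h
  rw [← h, Finset.sum_div]
  refine Finset.sum_congr rfl fun j _ => ?_
  rw [intervalIntegral.integral_of_le (hle j), integral_Ioc_eq_integral_Ioo,
    ← setIntegral_congr_fun measurableSet_Ioo (hpiece j), ← integral_Ioc_eq_integral_Ioo,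
    ← intervalIntegral.integral_of_le (hle j)]
  simp
  field_simp
  ring

/-! ### The tail sum -/

theorem exists_bound_of_tendsto {u : ℕ → ℝ} {a : ℝ} (h : Tendsto u atTop (𝓝 a)) :
    ∃ B, 0 ≤ B ∧ ∀ n, |u n| ≤ B := by
  obtain ⟨B, hB⟩ := (Metric.isBounded_range_of_tendsto u h).exists_norm_le
  exact ⟨B, (norm_nonneg _).trans (hB (u 0) ⟨0, rfl⟩), fun n => hB (u n) ⟨n, rfl⟩⟩

/-- The shift to j + 1 keeps the bound meaningful at j = 0 and matches nu < ⌊nu⌋ + 1. -/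
theorem exists_bound_mul_sqrt_succ {p : ℕ → ℝ} {A : ℝ}
    (hp : Tendsto (fun n : ℕ => p n * √(n : ℝ)) atTop (𝓝 A)) :
    ∃ B, 0 ≤ B ∧ ∀ j : ℕ, |p j| * √((j : ℝ) + 1) ≤ B := by
  obtain ⟨B, hB0, hB⟩ := exists_bound_of_tendsto hp
  refine ⟨2 * B + |p 0|, by positivity, fun j => ?_⟩
  rcases Nat.eq_zero_or_pos j with rfl | hj
  · simp; linarith
  · have hj1 : (1 : ℝ) ≤ j := by exact_mod_cast hj
    have h1 : √((j : ℝ) + 1) ≤ 2 * √(j : ℝ) := by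
      rw [Real.sqrt_le_left (by positivity), mul_pow, Real.sq_sqrt (by positivity)]
      linarith
    have h2 := hB j
    rw [abs_mul, abs_of_nonneg (Real.sqrt_nonneg _)] at h2
    have := mul_le_mul_of_nonneg_left h1 (abs_nonneg (p j))
    have := abs_nonneg (p 0)
    linarith

theorem tendsto_floor_mul_nat_div {u : ℝ} (hu : 0 ≤ u) :
    Tendsto (fun n : ℕ => (⌊(n : ℝ) * u⌋₊ : ℝ) / n) atTop (𝓝 u) := by
  have := (tendsto_nat_floor_mul_div_atTop hu).comp tendsto_natCast_atTop_atTop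
  simpa [Function.comp_def, mul_comm] using this

theorem tendsto_summand {p q : ℕ → ℝ} {A : ℝ} (hA : 0 < A)
    (hp : Tendsto (fun n : ℕ => p n * √(n : ℝ)) atTop (𝓝 A))
    (hq : Tendsto (fun k : ℕ => (k : ℝ) * q k) atTop (𝓝 (1 / 2))) {u : ℝ} (hu : u ∈ Ioo (0 : ℝ) 1) :
    Tendsto (fun n : ℕ => (n : ℝ) * (q (n - ⌊(n : ℝ) * u⌋₊) * p ⌊(n : ℝ) * u⌋₊) / p n) atTop
      (𝓝 (1 / (2 * (1 - u) * √(1 - (1 - u))))) := by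
  have hj := tendsto_floor_mul_nat_div hu.1.le
  have hfl : Tendsto (fun n : ℕ => ⌊(n : ℝ) * u⌋₊) atTop atTop :=
    tendsto_nat_floor_atTop.comp (tendsto_natCast_atTop_atTop.atTop_mul_const hu.1)
  have hle : ∀ n : ℕ, ⌊(n : ℝ) * u⌋₊ ≤ n := fun n => by
    refine Nat.floor_le_of_le ?_
    exact mul_le_of_le_one_right (by positivity) hu.2.le
  have hk : Tendsto (fun n : ℕ => n - ⌊(n : ℝ) * u⌋₊) atTop atTop := by
    rw [← tendsto_natCast_atTop_iff (R := ℝ)]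
    refine tendsto_atTop_mono (fun n => ?_)
      (tendsto_natCast_atTop_atTop.atTop_mul_const (show 0 < 1 - u by linarith [hu.2]))
    rw [Nat.cast_sub (hle n)]
    have := Nat.floor_le (show 0 ≤ (n : ℝ) * u by have := hu.1; positivity)
    linarith
  have h1 := hq.comp hk
  have h2 := hp.comp hfl
  have h3 : Tendsto (fun n : ℕ => 1 - (⌊(n : ℝ) * u⌋₊ : ℝ) / n) atTop (𝓝 (1 - u)) :=
    hj.const_sub 1
  have h4 := hj.sqrt
  have h1u : 1 - u ≠ 0 := by linarith [hu.2]
  have hsu : √u ≠ 0 := (Real.sqrt_pos.2 hu.1).ne'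
  have h5 := ((h1.div h3 h1u).mul (h2.div h4 hsu)).div hp hA.ne'
  have hlim : 1 / 2 / (1 - u) * (A / √u) / A = 1 / (2 * (1 - u) * √(1 - (1 - u))) := by
    rw [sub_sub_cancel]; field_simp
  rw [← hlim]
  refine h5.congr' ?_
  filter_upwards [eventually_gt_atTop 0, hfl.eventually_gt_atTop 0, hk.eventually_gt_atTop 0]
    with n hn hn1 hn2
  simp only [Function.comp_def, Pi.div_apply]
  have hn' : (0 : ℝ) < n := by exact_mod_cast hn
  have hn1' : (0 : ℝ) < ⌊(n : ℝ) * u⌋₊ := by exact_mod_cast hn1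
  have hn2' : (0 : ℝ) < (n - ⌊(n : ℝ) * u⌋₊ : ℕ) := by exact_mod_cast hn2
  have hk' : ((n - ⌊(n : ℝ) * u⌋₊ : ℕ) : ℝ) = n - ⌊(n : ℝ) * u⌋₊ := Nat.cast_sub (hle n)
  have he : 1 - (⌊(n : ℝ) * u⌋₊ : ℝ) / n = ((n - ⌊(n : ℝ) * u⌋₊ : ℕ) : ℝ) / n := by
    rw [hk']; field_simp
  rw [he, Real.sqrt_div hn1'.le]
  have hs1 := Real.sqrt_pos.2 hn1'
  have hs2 := Real.sqrt_pos.2 hn'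
  field_simp

theorem tendsto_tail_sum {p q : ℕ → ℝ} {A : ℝ} (hA : 0 < A)
    (hp : Tendsto (fun n : ℕ => p n * √(n : ℝ)) atTop (𝓝 A))
    (hq : Tendsto (fun k : ℕ => (k : ℝ) * q k) atTop (𝓝 (1 / 2))) {x : ℝ}
    (hx : x ∈ Icc (1 / 2 : ℝ) 1) :
    Tendsto (fun n : ℕ =>
      (∑ k ∈ (Finset.range (n + 1)).filter (fun k : ℕ => x * n < k), q k * p (n - k)) / p n)
      atTop (𝓝 (∫ y in x..1, 1 / (2 * y * √(1 - y)))) := by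
  obtain ⟨hx1, hx2⟩ := hx
  obtain ⟨B, hB0, hB⟩ := exists_bound_mul_sqrt_succ hp
  obtain ⟨B', hB'0, hB'⟩ := exists_bound_of_tendsto hq
  -- Here j = n - k is the number of vertices outside the large component and u = j/n; the factor n
  -- turns the sum into an integral over [0, 1].
  set G : ℕ → ℕ → ℝ := fun n j =>
    if x * n < (n - j : ℕ) then (n : ℝ) * (q (n - j) * p j) / p n else 0 with hG
  have hsum : ∀ᶠ n : ℕ in atTop, ∫ u in (0 : ℝ)..1, G n ⌊(n : ℝ) * u⌋₊ =
      (∑ k ∈ (Finset.range (n + 1)).filter (fun k : ℕ => x * n < k), q k * p (n - k)) / p n := by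
    filter_upwards [eventually_gt_atTop 0] with n hn
    have hn' : (0 : ℝ) < n := by exact_mod_cast hn
    have h := integral_step (G n) hn' n
    rw [div_self hn'.ne'] at h
    rw [h, Finset.sum_filter, ← Finset.sum_range_reflect _ (n + 1),
      Finset.sum_range_succ]
    have h0 : ¬ x * n < ((n + 1 - 1 - n : ℕ) : ℝ) := by
      simp; positivity
    rw [if_neg h0, add_zero, Finset.sum_div, Finset.sum_div]
    refine Finset.sum_congr rfl fun j hj => ?_
    have hj' : n - (n - j) = j := by have := Finset.mem_range.1 hj; omega
    simp only [hG, add_tsub_cancel_right, hj']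
    split_ifs
    · field_simp
    · simp
  refine Tendsto.congr' hsum ?_
  have hcv : ∫ y in x..1, 1 / (2 * y * √(1 - y)) =
      ∫ u in (0 : ℝ)..1, indicator {u | u ≤ 1 - x}
        (fun u => 1 / (2 * (1 - u) * √(1 - (1 - u)))) u := by
    rw [intervalIntegral.integral_indicator ⟨by linarith, by linarith⟩,
      intervalIntegral.integral_comp_sub_left (fun y => 1 / (2 * y * √(1 - y))) 1]
    simp
  rw [hcv]
  -- The dominating function combines |p_j| ≤ B/√(nu), n|q_{n-j}| ≤ 2B' (as n - j > n/2), and p_n ≥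
  -- A/(2√n).
  refine intervalIntegral.tendsto_integral_filter_of_dominated_convergence
    (fun u => 4 * B * B' / A * u ^ (-(1 / 2) : ℝ)) ?_ ?_ ?_ ?_
  · exact Eventually.of_forall fun n => (measurable_comp_floor (G n) n).aestronglyMeasurable
  · filter_upwards [eventually_gt_atTop 0, hp.eventually_const_le (show A / 2 < A by linarith)]
      with n hn hpn
    refine Eventually.of_forall fun u hu => ?_
    rw [uIoc_of_le zero_le_one] at hu
    have hn' : (0 : ℝ) < n := by exact_mod_cast hn
    have hu0 := hu.1
    have hsn := Real.sqrt_pos.2 hn'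
    have hsu := Real.sqrt_pos.2 hu0
    have hpos : 0 < p n := by
      by_contra! hneg
      have := mul_nonpos_of_nonpos_of_nonneg hneg hsn.le
      linarith
    rw [Real.norm_eq_abs, Real.rpow_neg hu0.le, ← Real.sqrt_eq_rpow]
    simp only [hG]
    split_ifs with hc
    · set j := ⌊(n : ℝ) * u⌋₊ with hj
      have hp1 : |p j| * (√(n : ℝ) * √u) ≤ B := by
        refine le_trans (mul_le_mul_of_nonneg_left ?_ (abs_nonneg _)) (hB j)
        rw [← Real.sqrt_mul hn'.le]
        exact Real.sqrt_le_sqrt (Nat.lt_floor_add_one _).le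
      have hq1 : (n : ℝ) / 2 * |q (n - j)| ≤ B' := by
        have h1 := hB' (n - j)
        rw [abs_mul, Nat.abs_cast] at h1
        have h2 : (n : ℝ) / 2 ≤ ((n - j : ℕ) : ℝ) := by nlinarith
        exact (mul_le_mul_of_nonneg_right h2 (abs_nonneg _)).trans h1
      rw [abs_div, abs_mul, abs_mul, abs_of_pos hpos, Nat.abs_cast, div_le_iff₀ hpos]
      have hq2 : (n : ℝ) * |q (n - j)| ≤ 2 * B' := by linarith
      have hp2 : |p j| ≤ B / (√(n : ℝ) * √u) := by rwa [le_div_iff₀ (by positivity)]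
      calc (n : ℝ) * (|q (n - j)| * |p j|) = (n * |q (n - j)|) * |p j| := by ring
        _ ≤ (2 * B') * (B / (√(n : ℝ) * √u)) := by gcongr
        _ = 4 * B * B' / A * (√u)⁻¹ * (A / 2 / √(n : ℝ)) := by field_simp; ring
        _ ≤ 4 * B * B' / A * (√u)⁻¹ * p n := by
          gcongr
          rwa [div_le_iff₀ hsn]
    · rw [abs_zero]; positivity
  · exact (intervalIntegral.intervalIntegrable_rpow' (by norm_num)).const_mul _
  -- Discarded are the jump of the indicator and the point where n - ⌊nu⌋ does not tend to infinity.
  · have hae : ∀ᵐ u : ℝ, u ≠ 1 - x ∧ u ≠ 1 :=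
      (Measure.ae_ne volume _).and (Measure.ae_ne volume _)
    filter_upwards [hae] with u hne hu
    rw [uIoc_of_le zero_le_one] at hu
    have hu' : u ∈ Ioo (0 : ℝ) 1 := ⟨hu.1, lt_of_le_of_ne hu.2 hne.2⟩
    have hle : ∀ n : ℕ, ⌊(n : ℝ) * u⌋₊ ≤ n := fun n =>
      Nat.floor_le_of_le (mul_le_of_le_one_right (by positivity) hu.2)
    rcases lt_or_gt_of_ne hne.1 with hlt | hgt
    · rw [indicator_of_mem (by exact hlt.le)]
      refine (tendsto_summand hA hp hq hu').congr' ?_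
      filter_upwards [eventually_gt_atTop 0] with n hn
      have hn' : (0 : ℝ) < n := by exact_mod_cast hn
      simp only [hG]
      rw [if_pos]
      rw [Nat.cast_sub (hle n)]
      have := Nat.floor_le (show 0 ≤ (n : ℝ) * u by have := hu.1; positivity)
      nlinarith
    · rw [indicator_of_notMem (by simpa using hgt)]
      refine tendsto_const_nhds.congr' ?_
      have hlarge : Tendsto (fun n : ℕ => (n : ℝ) * (u - (1 - x))) atTop atTop :=
        tendsto_natCast_atTop_atTop.atTop_mul_const (by linarith)
      filter_upwards [hlarge.eventually_ge_atTop 1] with n hn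
      simp only [hG]
      rw [if_neg]
      rw [Nat.cast_sub (hle n), not_lt]
      have := Nat.lt_floor_add_one ((n : ℝ) * u)
      linarith

section

/-! ### Classes of binary relations that split over components -/

/-- A property of binary relations, stated on every type, that is invariant under relabeling and
can be tested separately on the two parts of a partition not crossed by the relation. -/
structure IsDecomposable (P : ∀ V : Type, (V → V → Prop) → Prop) : Prop where
  congr : ∀ {V W : Type} (e : V ≃ W) (r : W → W → Prop), P W r → P V (fun a b => r (e a) (e b))
  split : ∀ {V : Type} (S : Set V) (r : V → V → Prop), (∀ a b, r a b → (a ∈ S ↔ b ∈ S)) →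
    (P V r ↔ P S (fun a b => r a b) ∧ P ↥Sᶜ (fun a b => r a b))

/-- The number of relations on `n` labeled points in the class `P`. -/
noncomputable def totalCount (P : ∀ V : Type, (V → V → Prop) → Prop) (n : ℕ) : ℕ :=
  Nat.card {r : Fin n → Fin n → Prop // P _ r}

/-- The number of connected relations on `n` labeled points in the class `P`. -/
noncomputable def connectedCount (P : ∀ V : Type, (V → V → Prop) → Prop) (n : ℕ) : ℕ :=
  Nat.card {r : Fin n → Fin n → Prop // P _ r ∧ (SimpleGraph.fromRel r).Connected}

/-- `S` is the vertex set of a component of the graph underlying `r`. -/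
def IsComponent {V : Type} (r : V → V → Prop) (S : Set V) : Prop :=
  ∃ c : (SimpleGraph.fromRel r).ConnectedComponent, c.supp = S

theorem fromRel_restrict {V : Type} (r : V → V → Prop) (S : Set V) :
    SimpleGraph.fromRel (fun a b : S => r a b) = (SimpleGraph.fromRel r).induce S := by
  ext a b
  simp [Subtype.ext_iff]

theorem fromRel_connected_congr {V W : Type} (e : V ≃ W) (r : W → W → Prop) :
    (SimpleGraph.fromRel fun a b => r (e a) (e b)).Connected ↔
      (SimpleGraph.fromRel r).Connected := by
  let i : (SimpleGraph.fromRel fun a b => r (e a) (e b)) ≃g SimpleGraph.fromRel r :=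
    ⟨e, by intro a b; simp⟩
  exact i.connected_iff

theorem IsComponent.closed {V : Type} {r : V → V → Prop} {S : Set V} (h : IsComponent r S)
    (a b : V) (hab : r a b) : a ∈ S ↔ b ∈ S := by
  obtain ⟨c, rfl⟩ := h
  rcases eq_or_ne a b with rfl | hne
  · rfl
  · exact c.mem_supp_congr_adj (by simp [hne, hab])

theorem mem_of_reachable {V : Type} {G : SimpleGraph V} {S : Set V}
    (hS : ∀ a b, G.Adj a b → a ∈ S → b ∈ S) {a b : V} (hab : G.Reachable a b) (ha : a ∈ S) :
    b ∈ S := by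
  obtain ⟨w⟩ := hab
  induction w with
  | nil => exact ha
  | cons h _ ih => exact ih (hS _ _ h ha)

/-- This form involves only closedness of S and the restriction to S, so it can be checked on a
glued relation. -/
theorem isComponent_iff {V : Type} (r : V → V → Prop) (S : Set V) :
    IsComponent r S ↔ (∀ a b, r a b → (a ∈ S ↔ b ∈ S)) ∧
      (SimpleGraph.fromRel fun a b : S => r a b).Connected := by
  constructor
  · intro h
    refine ⟨h.closed, ?_⟩
    rw [fromRel_restrict]
    obtain ⟨c, rfl⟩ := h
    exact c.connected_toSimpleGraph
  · rintro ⟨hcl, hconn⟩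
    rw [fromRel_restrict] at hconn
    obtain ⟨a⟩ := hconn.nonempty
    refine ⟨(SimpleGraph.fromRel r).connectedComponentMk a, ?_⟩
    ext b
    rw [SimpleGraph.ConnectedComponent.mem_supp_iff, SimpleGraph.ConnectedComponent.eq]
    constructor
    · intro h
      refine mem_of_reachable (fun u v huv hu => ?_) h.symm a.2
      rw [SimpleGraph.fromRel_adj] at huv
      rcases huv.2 with h | h
      · exact (hcl _ _ h).1 hu
      · exact (hcl _ _ h).2 hu
    · intro hb
      exact (hconn.preconnected ⟨b, hb⟩ a).map (SimpleGraph.Embedding.induce S).toHom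

/-- The relation on `V` that restricts to `r` on `S` and to `s` on the complement of `S`. -/
def glue {V : Type} (S : Set V) (r : S → S → Prop) (s : ↥Sᶜ → ↥Sᶜ → Prop) (a b : V) : Prop :=
  (∃ (ha : a ∈ S) (hb : b ∈ S), r ⟨a, ha⟩ ⟨b, hb⟩) ∨
    ∃ (ha : a ∈ Sᶜ) (hb : b ∈ Sᶜ), s ⟨a, ha⟩ ⟨b, hb⟩

theorem glue_left {V : Type} (S : Set V) (r : S → S → Prop) (s : ↥Sᶜ → ↥Sᶜ → Prop) :
    (fun a b : S => glue S r s a b) = r := by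
  ext a b
  simp [glue]

theorem glue_right {V : Type} (S : Set V) (r : S → S → Prop) (s : ↥Sᶜ → ↥Sᶜ → Prop) :
    (fun a b : ↥Sᶜ => glue S r s a b) = s := by
  ext ⟨a, ha⟩ ⟨b, hb⟩
  simp only [mem_compl_iff] at ha hb
  simp [glue, ha, hb]

theorem glue_closed {V : Type} (S : Set V) (r : S → S → Prop) (s : ↥Sᶜ → ↥Sᶜ → Prop) (a b : V)
    (h : glue S r s a b) : a ∈ S ↔ b ∈ S := by
  rcases h with ⟨ha, hb, _⟩ | ⟨ha, hb, _⟩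
  · simp [ha, hb]
  · simp only [mem_compl_iff] at ha hb
    simp [ha, hb]

theorem glue_restrict {V : Type} (S : Set V) (r : V → V → Prop)
    (h : ∀ a b, r a b → (a ∈ S ↔ b ∈ S)) :
    glue S (fun a b : S => r a b) (fun a b : ↥Sᶜ => r a b) = r := by
  ext a b
  simp only [glue, mem_compl_iff, exists_prop]
  have := h a b
  tauto

variable {P : ∀ V : Type, (V → V → Prop) → Prop}

/-- A relation of the class with component `S` amounts to a connected one on `S` together with an
arbitrary one on the complement. -/
def componentEquiv (hP : IsDecomposable P) {V : Type} (S : Set V) :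
    {r : V → V → Prop // P V r ∧ IsComponent r S} ≃
      {r : S → S → Prop // P S r ∧ (SimpleGraph.fromRel r).Connected} ×
        {r : ↥Sᶜ → ↥Sᶜ → Prop // P ↥Sᶜ r} where
  toFun r := (⟨fun a b => r.1 a b, ((hP.split S r.1 r.2.2.closed).1 r.2.1).1,
      ((isComponent_iff r.1 S).1 r.2.2).2⟩,
    ⟨fun a b => r.1 a b, ((hP.split S r.1 r.2.2.closed).1 r.2.1).2⟩)
  invFun x := ⟨glue S x.1.1 x.2.1, by
      rw [hP.split S _ (glue_closed S _ _), glue_left, glue_right]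
      exact ⟨x.1.2.1, x.2.2⟩, by
      rw [isComponent_iff, glue_left]
      exact ⟨glue_closed S _ _, x.1.2.2⟩⟩
  left_inv r := Subtype.ext (glue_restrict S r.1 r.2.2.closed)
  right_inv x := Prod.ext (Subtype.ext (glue_left S _ _)) (Subtype.ext (glue_right S _ _))

theorem IsDecomposable.congr_iff (hP : IsDecomposable P) {V W : Type} (e : V ≃ W)
    (r : W → W → Prop) : P W r ↔ P V (fun a b => r (e a) (e b)) := by
  refine ⟨hP.congr e r, fun h => ?_⟩
  simpa using hP.congr e.symm _ h

theorem card_eq_totalCount (hP : IsDecomposable P) {V : Type} {n : ℕ} (e : Fin n ≃ V) :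
    Nat.card {r : V → V → Prop // P V r} = totalCount P n := by
  refine Nat.card_congr (Equiv.subtypeEquiv
    (e.symm.arrowCongr (e.symm.arrowCongr (Equiv.refl Prop))) fun r => ?_)
  rw [hP.congr_iff e]
  rfl

theorem card_eq_connectedCount (hP : IsDecomposable P) {V : Type} {n : ℕ} (e : Fin n ≃ V) :
    Nat.card {r : V → V → Prop // P V r ∧ (SimpleGraph.fromRel r).Connected} =
      connectedCount P n := by
  refine Nat.card_congr (Equiv.subtypeEquiv
    (e.symm.arrowCongr (e.symm.arrowCongr (Equiv.refl Prop))) fun r => ?_)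
  rw [hP.congr_iff e, ← fromRel_connected_congr e]
  rfl

theorem card_isComponent (hP : IsDecomposable P) {n : ℕ} (S : Finset (Fin n)) :
    Nat.card {r : Fin n → Fin n → Prop // P _ r ∧ IsComponent r (S : Set (Fin n))} =
      connectedCount P S.card * totalCount P (n - S.card) := by
  classical
  rw [Nat.card_congr (componentEquiv hP (S : Set (Fin n))), Nat.card_prod]
  congr 1
  · exact card_eq_connectedCount hP (Fintype.equivFinOfCardEq (by simp)).symm
  · refine card_eq_totalCount hP (Fintype.equivFinOfCardEq ?_).symm
    rw [Fintype.card_compl_set]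
    simp

/-! ### Double counting of components -/

open Classical in
-- The weight is free because two are needed: w k = k yields the recurrence, and the indicator of k
-- > xn yields the tail count.
theorem sum_components_eq (hP : IsDecomposable P) (n : ℕ) (w : ℕ → ℕ) :
    ∑ r : {r : Fin n → Fin n → Prop // P _ r}, ∑ S : Finset (Fin n),
        (if IsComponent r.1 (S : Set (Fin n)) then w S.card else 0) =
      ∑ k ∈ Finset.range (n + 1),
        n.choose k * (w k * (connectedCount P k * totalCount P (n - k))) := by
  rw [Finset.sum_comm]
  have h : ∀ S : Finset (Fin n), ∑ r : {r : Fin n → Fin n → Prop // P _ r},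
      (if IsComponent r.1 (S : Set (Fin n)) then w S.card else 0) =
      w S.card * (connectedCount P S.card * totalCount P (n - S.card)) := by
    intro S
    rw [← card_isComponent hP S, ← Finset.sum_filter, Finset.sum_const, smul_eq_mul, mul_comm]
    congr 1
    rw [← Fintype.card_subtype, ← Nat.card_eq_fintype_card]
    exact Nat.card_congr (Equiv.subtypeSubtypeEquivSubtypeInter
      (P (Fin n)) (fun r => IsComponent r (S : Set (Fin n))))
  simp_rw [h]
  have := Finset.sum_powerset_apply_card
    (fun k => w k * (connectedCount P k * totalCount P (n - k)))
    (x := (Finset.univ : Finset (Fin n)))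
  simpa using this

theorem IsComponent.eq_of_mem {V : Type} {r : V → V → Prop} {S T : Set V} {v : V}
    (hS : IsComponent r S) (hT : IsComponent r T) (hvS : v ∈ S) (hvT : v ∈ T) : S = T := by
  obtain ⟨c, rfl⟩ := hS
  obtain ⟨d, rfl⟩ := hT
  rw [SimpleGraph.ConnectedComponent.mem_supp_iff] at hvS hvT
  rw [← hvS, ← hvT]

theorem exists_isComponent_mem {V : Type} [Fintype V] (r : V → V → Prop) (v : V) :
    ∃ S : Finset V, IsComponent r (S : Set V) ∧ v ∈ S := by
  classical
  refine ⟨((SimpleGraph.fromRel r).connectedComponentMk v).supp.toFinset, ⟨_, by simp; rfl⟩, ?_⟩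
  simp

open Classical in
theorem sum_card_components {n : ℕ} (r : Fin n → Fin n → Prop) :
    ∑ S : Finset (Fin n), (if IsComponent r (S : Set (Fin n)) then S.card else 0) = n := by
  have h1 : ∀ S : Finset (Fin n), (if IsComponent r (S : Set (Fin n)) then S.card else 0) =
      ∑ v : Fin n, if IsComponent r (S : Set (Fin n)) ∧ v ∈ S then 1 else 0 := by
    intro S
    split_ifs with h <;> simp [h]
  simp_rw [h1]
  rw [Finset.sum_comm]
  have h2 : ∀ v : Fin n, ∑ S : Finset (Fin n),
      (if IsComponent r (S : Set (Fin n)) ∧ v ∈ S then 1 else 0) = 1 := by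
    intro v
    obtain ⟨S, hS, hv⟩ := exists_isComponent_mem r v
    rw [Finset.sum_eq_single S]
    · simp [hS, hv]
    · intro T _ hne
      rw [if_neg]
      rintro ⟨hT, hvT⟩
      exact hne (Finset.coe_injective (hT.eq_of_mem hS hvT hv))
    · simp
  simp [h2]

theorem mul_totalCount (hP : IsDecomposable P) (n : ℕ) :
    n * totalCount P n = ∑ k ∈ Finset.range (n + 1),
      n.choose k * (k * (connectedCount P k * totalCount P (n - k))) := by
  classical
  rw [← sum_components_eq hP n (fun k => k)]
  simp_rw [sum_card_components]
  rw [Finset.sum_const, smul_eq_mul, mul_comm, Finset.card_univ, ← Nat.card_eq_fintype_card]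
  rfl

open Classical in
-- Two distinct components are disjoint and cannot both exceed n/2, so the count of large components
-- is an indicator.
theorem sum_large_components {n : ℕ} (r : Fin n → Fin n → Prop) {x : ℝ} (hx : 1 / 2 ≤ x) :
    ∑ S : Finset (Fin n), (if IsComponent r (S : Set (Fin n)) then
        (if x * n < S.card then 1 else 0) else 0) =
      if ∃ S : Finset (Fin n), IsComponent r (S : Set (Fin n)) ∧ x * n < S.card then 1 else 0 := by
  split_ifs with h
  · obtain ⟨S, hS, hcard⟩ := h
    rw [Finset.sum_eq_single S]
    · simp [hS, hcard]
    · intro T _ hne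
      rw [ite_eq_right_iff]
      intro hT
      rw [if_neg]
      intro hcardT
      have hdisj : Disjoint T S := by
        rw [Finset.disjoint_left]
        intro v hvT hvS
        exact hne (Finset.coe_injective (hT.eq_of_mem hS hvT hvS))
      have hle : T.card + S.card ≤ n := by
        rw [← Finset.card_union_of_disjoint hdisj]
        simpa using Finset.card_le_univ (T ∪ S)
      have hle' : (T.card : ℝ) + S.card ≤ n := by exact_mod_cast hle
      have : (0 : ℝ) ≤ n := by positivity
      nlinarith
    · simp
  · refine Finset.sum_eq_zero fun S _ => ?_
    rw [ite_eq_right_iff]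
    intro hS
    rw [if_neg]
    exact fun hc => h ⟨S, hS, hc⟩

theorem lt_largestComponent_iff {n : ℕ} (r : Fin n → Fin n → Prop) {x : ℝ} (hx : 0 ≤ x) :
    x * n < (largestComponent (SimpleGraph.fromRel r) : ℝ) ↔
      ∃ S : Finset (Fin n), IsComponent r (S : Set (Fin n)) ∧ x * n < S.card := by
  classical
  have hfin : Finite (SimpleGraph.fromRel r).ConnectedComponent := inferInstance
  constructor
  · intro h
    rcases isEmpty_or_nonempty (SimpleGraph.fromRel r).ConnectedComponent with he | hne
    · rw [largestComponent, ciSup_of_empty] at h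
      have : (0 : ℝ) ≤ x * n := by positivity
      simp at h
      linarith
    · obtain ⟨c, hc⟩ := exists_eq_ciSup_of_finite
        (f := fun c : (SimpleGraph.fromRel r).ConnectedComponent => c.supp.ncard)
      refine ⟨c.supp.toFinset, ⟨c, by simp⟩, ?_⟩
      rw [largestComponent, ← hc] at h
      rwa [← Set.ncard_eq_toFinset_card']
  · rintro ⟨S, ⟨c, hc⟩, hS⟩
    refine hS.trans_le ?_
    have h := le_ciSup (f := fun c : (SimpleGraph.fromRel r).ConnectedComponent => c.supp.ncard)
      (Set.finite_range _).bddAbove c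
    simp only [hc, Set.ncard_coe_finset] at h
    exact_mod_cast h

theorem card_lt_largestComponent (hP : IsDecomposable P) (n : ℕ) {x : ℝ} (hx : 1 / 2 ≤ x) :
    Nat.card {r : {r : Fin n → Fin n → Prop // P _ r} //
        x * n < (largestComponent (SimpleGraph.fromRel r.1) : ℝ)} =
      ∑ k ∈ (Finset.range (n + 1)).filter (fun k : ℕ => x * n < k),
        n.choose k * (connectedCount P k * totalCount P (n - k)) := by
  classical
  have h := sum_components_eq hP n (fun k => if x * n < (k : ℝ) then 1 else 0)
  simp_rw [sum_large_components _ hx] at h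
  rw [← Finset.sum_filter, Finset.sum_const, smul_eq_mul, mul_one, ← Fintype.card_subtype,
    ← Nat.card_eq_fintype_card] at h
  simp_rw [lt_largestComponent_iff _ (show 0 ≤ x by linarith)]
  rw [h, Finset.sum_filter]
  refine Finset.sum_congr rfl fun k _ => ?_
  split_ifs <;> simp

/-! ### The limit law of the largest component -/

/-- Since ρ^n = ρ^k ρ^(n-k), the scale ρ cancels and may be chosen to suit the asymptotics. -/
theorem uniformProb_lt_largestComponent (hP : IsDecomposable P) {ρ : ℝ} (hρ : 0 < ρ) (n : ℕ)
    {x : ℝ} (hx : 1 / 2 ≤ x) :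
    uniformProb (fun r : {r : Fin n → Fin n → Prop // P _ r} =>
        x * n < (largestComponent (SimpleGraph.fromRel r.1) : ℝ)) =
      (∑ k ∈ (Finset.range (n + 1)).filter (fun k : ℕ => x * n < k),
        (connectedCount P k / (k.factorial * ρ ^ k) : ℝ) *
          (totalCount P (n - k) / ((n - k).factorial * ρ ^ (n - k)))) /
        (totalCount P n / (n.factorial * ρ ^ n)) := by
  have hne : (n.factorial : ℝ) * ρ ^ n ≠ 0 := by positivity
  rw [uniformProb, card_lt_largestComponent hP n hx, ← totalCount, div_div_eq_mul_div]
  congr 1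
  rw [Nat.cast_sum, Finset.sum_mul]
  refine Finset.sum_congr rfl fun k hk => ?_
  have hk' : k ≤ n := by
    have := Finset.mem_range.1 (Finset.mem_filter.1 hk).1; omega
  rw [← Nat.choose_mul_factorial_mul_factorial hk']
  have hpow : ρ ^ n = ρ ^ k * ρ ^ (n - k) := by rw [← pow_add, Nat.add_sub_cancel' hk']
  rw [hpow]
  push_cast
  field_simp

theorem tendsto_uniformProb_largestComponent (hP : IsDecomposable P) {ρ A : ℝ} (hρ : 0 < ρ)
    (hA : 0 < A)
    (hp : Tendsto (fun n : ℕ => (totalCount P n / (n.factorial * ρ ^ n) : ℝ) * √(n : ℝ)) atTop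
      (𝓝 A))
    (hq : Tendsto (fun k : ℕ => (k : ℝ) * (connectedCount P k / (k.factorial * ρ ^ k) : ℝ)) atTop
      (𝓝 (1 / 2))) {x : ℝ} (hx : x ∈ Icc (1 / 2 : ℝ) 1) :
    Tendsto (fun n : ℕ => uniformProb (fun r : {r : Fin n → Fin n → Prop // P _ r} =>
        x * n < (largestComponent (SimpleGraph.fromRel r.1) : ℝ))) atTop
      (𝓝 (∫ y in x..1, 1 / (2 * y * √(1 - y)))) := by
  refine (tendsto_tail_sum hA hp hq hx).congr fun n => ?_
  rw [uniformProb_lt_largestComponent hP hρ n hx.1]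

theorem uniformProb_congr {α β : Type*} (e : α ≃ β) {p : α → Prop} {q : β → Prop}
    (h : ∀ a, p a ↔ q (e a)) : uniformProb p = uniformProb q := by
  rw [uniformProb, uniformProb, Nat.card_congr e, Nat.card_congr (e.subtypeEquiv h)]

end

/-! ### Relations of constant out-degree -/

/-- Every element is related to exactly `d` elements. -/
def HasOutDegree (d : ℕ) (V : Type) (r : V → V → Prop) : Prop :=
  ∀ a, {b | r a b}.ncard = d

theorem ncard_restrict {V : Type} (S : Set V) {r : V → V → Prop}
    (h : ∀ a b, r a b → (a ∈ S ↔ b ∈ S)) (a : S) :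
    {b : S | r a b}.ncard = {b : V | r a b}.ncard := by
  rw [← Set.ncard_image_of_injective _ Subtype.val_injective]
  congr 1
  ext b
  simp only [mem_image, mem_ofPred_eq, Subtype.exists, exists_and_right, exists_eq_right]
  exact ⟨fun ⟨_, hb⟩ => hb, fun hb => ⟨(h _ _ hb).1 a.2, hb⟩⟩

theorem HasOutDegree.isDecomposable (d : ℕ) : IsDecomposable (HasOutDegree d) where
  congr e r h a := by
    rw [← h (e a), ← Set.ncard_image_of_injective _ e.injective]
    congr 1
    ext b
    simp only [mem_image, mem_ofPred_eq]
    exact ⟨fun ⟨c, hc, hcb⟩ => hcb ▸ hc, fun hb => ⟨e.symm b, by simpa using hb, by simp⟩⟩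
  split S r h := by
    have h' : ∀ a b, r a b → (a ∈ Sᶜ ↔ b ∈ Sᶜ) := fun a b hab => not_congr (h a b hab)
    refine ⟨fun hr => ⟨fun a => ?_, fun a => ?_⟩, fun hr a => ?_⟩
    · rw [ncard_restrict S h, hr]
    · rw [ncard_restrict Sᶜ h', hr]
    · by_cases ha : a ∈ S
      · rw [← ncard_restrict S h ⟨a, ha⟩, hr.1]
      · rw [← ncard_restrict Sᶜ h' ⟨a, ha⟩, hr.2]

theorem IsDecomposable.and {P Q : ∀ V : Type, (V → V → Prop) → Prop} (hP : IsDecomposable P)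
    (hQ : IsDecomposable Q) : IsDecomposable fun V r => P V r ∧ Q V r where
  congr e r h := ⟨hP.congr e r h.1, hQ.congr e r h.2⟩
  split S r h := by
    rw [hP.split S r h, hQ.split S r h]
    tauto

theorem IsDecomposable.flip {P : ∀ V : Type, (V → V → Prop) → Prop} (hP : IsDecomposable P) :
    IsDecomposable fun V r => P V (fun a b => r b a) where
  congr e _ h := hP.congr e _ h
  split S _ h := hP.split S _ fun a b hab => (h b a hab).symm

theorem isDecomposable_symmetric : IsDecomposable fun _ r => ∀ a b, r a b → r b a where
  congr _ _ h a b hab := h _ _ hab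
  split S r h := by
    refine ⟨fun hr => ⟨fun a b => hr a b, fun a b => hr a b⟩, fun hr a b hab => ?_⟩
    by_cases ha : a ∈ S
    · exact hr.1 ⟨a, ha⟩ ⟨b, (h a b hab).1 ha⟩ hab
    · exact hr.2 ⟨a, ha⟩ ⟨b, (not_congr (h a b hab)).1 ha⟩ hab

theorem isDecomposable_irreflexive : IsDecomposable fun _ r => ∀ a, ¬ r a a where
  congr _ _ h a := h _
  split S r _ := by
    refine ⟨fun hr => ⟨fun a => hr a, fun a => hr a⟩, fun hr a => ?_⟩
    by_cases ha : a ∈ S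
    · exact hr.1 ⟨a, ha⟩
    · exact hr.2 ⟨a, ha⟩

/-- A map as a relation of out-degree one. -/
noncomputable def mapEquiv (V : Type) : (V → V) ≃ {r : V → V → Prop // HasOutDegree 1 V r} :=
  Equiv.ofBijective (fun f => ⟨fun a b => f a = b, fun a => by simp⟩) <| by
    constructor
    · intro f g hfg
      funext a
      have := congrFun (congrFun (congrArg Subtype.val hfg) a) (g a)
      simpa using this
    · rintro ⟨r, hr⟩
      have h := fun a => Set.ncard_eq_one.1 (hr a)
      choose f hf using h
      refine ⟨f, Subtype.ext ?_⟩
      ext a b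
      have : b ∈ {b | r a b} ↔ b = f a := by rw [hf a]; rfl
      simp only [mem_ofPred_eq] at this
      exact eq_comm.trans this.symm

theorem totalCount_map (n : ℕ) : totalCount (HasOutDegree 1) n = n ^ n := by
  rw [totalCount, ← Nat.card_congr (mapEquiv (Fin n))]
  simp

/-! ### The normalized recurrence -/

/-- The coefficient form of zT' = (zC')T for exponential generating functions T = exp C. -/
theorem normalized_recurrence {P : ∀ V : Type, (V → V → Prop) → Prop} (hP : IsDecomposable P)
    (n : ℕ) :
    (n : ℝ) * (totalCount P n / n.factorial) = ∑ k ∈ Finset.range (n + 1),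
      ((k : ℝ) * (connectedCount P k / k.factorial)) *
        (totalCount P (n - k) / (n - k).factorial) := by
  have hne : (n.factorial : ℝ) ≠ 0 := by positivity
  have h : ((n * totalCount P n : ℕ) : ℝ) = _ := congrArg _ (mul_totalCount hP n)
  push_cast at h
  rw [← mul_div_assoc, h, Finset.sum_div]
  refine Finset.sum_congr rfl fun k hk => ?_
  have hk' : k ≤ n := by have := Finset.mem_range.1 hk; omega
  rw [← Nat.choose_mul_factorial_mul_factorial hk']
  have : (n.choose k : ℝ) ≠ 0 := by exact_mod_cast (Nat.choose_pos hk').ne'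
  push_cast
  field_simp

theorem eq_of_convolution_eq {t s b : ℕ → ℝ} (hb : b 0 ≠ 0)
    (h : ∀ n, ∑ k ∈ Finset.range (n + 1), t k * b (n - k) =
      ∑ k ∈ Finset.range (n + 1), s k * b (n - k)) (n : ℕ) : t n = s n := by
  induction n using Nat.strong_induction_on with
  | _ n ih =>
    have hn := h n
    rw [Finset.sum_range_succ, Finset.sum_range_succ, Finset.sum_congr rfl fun k hk => by
      rw [ih k (Finset.mem_range.1 hk)]] at hn
    simpa [hb] using hn

/-! ### Abel's identity and the number of connected mappings -/

/-- The M-th finite difference of x^M is M!. -/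
theorem sum_alternating_pow (x : ℝ) (M : ℕ) :
    ∑ m ∈ Finset.range (M + 1),
      (-1 : ℝ) ^ (M - m) * (x + m) ^ M / (m.factorial * (M - m).factorial) = 1 := by
  have h1 := congrFun (fwdDiff_iter_eq_factorial (R := ℝ) (n := M)) x
  rw [fwdDiff_iter_eq_sum_shift] at h1
  have hne : (M.factorial : ℝ) ≠ 0 := by positivity
  replace h1 := congrArg (fun z : ℝ => z / M.factorial) h1
  simp only [Pi.natCast_apply, div_self hne] at h1
  refine Eq.trans ?_ h1
  rw [Finset.sum_div]
  refine Finset.sum_congr rfl fun m hm => ?_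
  have hm' : m ≤ M := by have := Finset.mem_range.1 hm; omega
  have : (M.choose m : ℝ) ≠ 0 := by exact_mod_cast (Nat.choose_pos hm').ne'
  rw [← Nat.choose_mul_factorial_mul_factorial hm']
  simp only [zsmul_eq_mul, nsmul_eq_mul, mul_one]
  push_cast
  field_simp

/-- Expand y + N - m = (x + y + N) - (x + m) binomially. The coefficient of (x + y + N)^i / i! is
then the alternating sum above with M = N - i, which is 1. -/
theorem abel_sum (x y : ℝ) (N : ℕ) :
    ∑ m ∈ Finset.range (N + 1), (x + m) ^ m / m.factorial *
        ((y + (N - m : ℕ)) ^ (N - m) / (N - m).factorial) =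
      ∑ i ∈ Finset.range (N + 1), (x + y + N) ^ i / i.factorial := by
  have hterm : ∀ m ∈ Finset.range (N + 1), (x + m) ^ m / m.factorial *
      ((y + (N - m : ℕ)) ^ (N - m) / (N - m).factorial) =
      ∑ i ∈ Finset.range (N - m + 1), (x + y + N) ^ i / i.factorial *
        ((-1 : ℝ) ^ (N - i - m) * (x + m) ^ (N - i) / (m.factorial * (N - i - m).factorial)) := by
    intro m hm
    have hm' : m ≤ N := by have := Finset.mem_range.1 hm; omega
    have hy : y + (N - m : ℕ) = (x + y + N) + -(x + m) := by
      rw [Nat.cast_sub hm']; ring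
    rw [hy, add_pow (x + y + N) (-(x + m)), Finset.sum_div, Finset.mul_sum]
    refine Finset.sum_congr rfl fun i hi => ?_
    have hi' : i ≤ N - m := by have := Finset.mem_range.1 hi; omega
    have hch : ((N - m).choose i : ℝ) ≠ 0 := by exact_mod_cast (Nat.choose_pos hi').ne'
    rw [← Nat.choose_mul_factorial_mul_factorial hi', neg_pow (x + m : ℝ),
      show N - i - m = N - m - i by omega,
      show (x + m : ℝ) ^ (N - i) = (x + m) ^ m * (x + m) ^ (N - m - i) by
        rw [← pow_add]; congr 1; omega]
    push_cast
    field_simp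
  rw [Finset.sum_congr rfl hterm, Finset.sum_comm' (t' := Finset.range (N + 1))
    (s' := fun i => Finset.range (N - i + 1)) (by intro m i; simp only [Finset.mem_range]; omega)]
  refine Finset.sum_congr rfl fun i _ => ?_
  rw [← Finset.mul_sum, sum_alternating_pow, mul_one]

theorem sum_sub_mul_pow_div_factorial (z : ℝ) (M : ℕ) :
    ∑ i ∈ Finset.range M, (z - i) * (z ^ i / i.factorial) = M * (z ^ M / M.factorial) := by
  induction M with
  | zero => simp
  | succ M ih =>
    rw [Finset.sum_range_succ, ih, Nat.factorial_succ]
    push_cast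
    field_simp
    ring

/-- Regrouping by N = n - k + m makes each inner sum an Abel sum with x = n - N, y = 0. The term
n^i/i! then occurs for n - i values of N, and the result telescopes. -/
theorem mapping_convolution (n : ℕ) :
    ∑ k ∈ Finset.range (n + 1), (∑ m ∈ Finset.range k, (k : ℝ) ^ m / m.factorial) *
        (((n - k : ℕ) : ℝ) ^ (n - k) / (n - k).factorial) =
      n * ((n : ℝ) ^ n / n.factorial) := by
  have h1 : ∑ k ∈ Finset.range (n + 1), (∑ m ∈ Finset.range k, (k : ℝ) ^ m / m.factorial) *
        (((n - k : ℕ) : ℝ) ^ (n - k) / (n - k).factorial) =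
      ∑ N ∈ Finset.range n, ∑ m ∈ Finset.range (N + 1),
        (((n - N : ℕ) : ℝ) + m) ^ m / m.factorial *
          ((0 + (N - m : ℕ)) ^ (N - m) / (N - m).factorial) := by
    simp_rw [Finset.sum_mul]
    rw [Finset.sum_sigma', Finset.sum_sigma']
    refine Finset.sum_nbij' (fun x => ⟨n - x.1 + x.2, x.2⟩) (fun x => ⟨n - x.1 + x.2, x.2⟩)
      ?_ ?_ ?_ ?_ ?_
    · rintro ⟨k, m⟩ h
      simp only [Finset.mem_sigma, Finset.mem_range] at h ⊢
      omega
    · rintro ⟨k, m⟩ h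
      simp only [Finset.mem_sigma, Finset.mem_range] at h ⊢
      omega
    · rintro ⟨k, m⟩ h
      simp only [Finset.mem_sigma, Finset.mem_range] at h
      have : n - (n - k + m) + m = k := by omega
      simp [this]
    · rintro ⟨k, m⟩ h
      simp only [Finset.mem_sigma, Finset.mem_range] at h
      have : n - (n - k + m) + m = k := by omega
      simp [this]
    · rintro ⟨k, m⟩ h
      simp only [Finset.mem_sigma, Finset.mem_range] at h
      have e1 : ((n - (n - k + m) : ℕ) : ℝ) + m = k := by
        rw [← Nat.cast_add]; congr 1; omega
      simp only [e1, Nat.add_sub_cancel, zero_add]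
  have h2 : ∀ N ∈ Finset.range n, ∑ m ∈ Finset.range (N + 1),
        (((n - N : ℕ) : ℝ) + m) ^ m / m.factorial *
          ((0 + (N - m : ℕ)) ^ (N - m) / (N - m).factorial) =
      ∑ i ∈ Finset.range (N + 1), (n : ℝ) ^ i / i.factorial := by
    intro N hN
    rw [abel_sum]
    have : ((n - N : ℕ) : ℝ) + 0 + N = n := by
      rw [Nat.cast_sub (Finset.mem_range.1 hN).le]; ring
    rw [this]
  rw [h1, Finset.sum_congr rfl h2, ← sum_sub_mul_pow_div_factorial,
    Finset.sum_comm' (t' := Finset.range n) (s' := fun i => Finset.Ico i n)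
      (by intro N i; simp only [Finset.mem_range, Finset.mem_Ico]; omega)]
  refine Finset.sum_congr rfl fun i hi => ?_
  rw [Finset.sum_const, Nat.card_Ico, nsmul_eq_mul, Nat.cast_sub (Finset.mem_range.1 hi).le]

theorem connectedCount_map (k : ℕ) :
    (k : ℝ) * (connectedCount (HasOutDegree 1) k / k.factorial) =
      ∑ m ∈ Finset.range k, (k : ℝ) ^ m / m.factorial := by
  refine eq_of_convolution_eq
    (t := fun k => (k : ℝ) * (connectedCount (HasOutDegree 1) k / k.factorial))
    (s := fun k => ∑ m ∈ Finset.range k, (k : ℝ) ^ m / m.factorial)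
    (b := fun n => (n : ℝ) ^ n / n.factorial) (by simp) (fun n => ?_) k
  rw [mapping_convolution]
  have h := normalized_recurrence (HasOutDegree.isDecomposable 1) n
  simp only [totalCount_map, Nat.cast_pow] at h
  exact h.symm

/-! ### Asymptotics for mappings -/

theorem tendsto_mapping_total :
    Tendsto (fun n : ℕ => ((n : ℝ) ^ n / (n.factorial * Real.exp 1 ^ n)) * √(n : ℝ)) atTop
      (𝓝 (1 / (√Real.pi * √2))) := by
  have h := Stirling.tendsto_stirlingSeq_sqrt_pi.mul_const (√2)
  have hpos : √Real.pi * √2 ≠ 0 := by positivity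
  refine (tendsto_const_nhds.div h hpos).congr' ?_
  filter_upwards [eventually_gt_atTop 0] with n hn
  have hn' : (0 : ℝ) < n := by exact_mod_cast hn
  have hs := Real.sqrt_pos.2 hn'
  simp only [Pi.div_apply, Stirling.stirlingSeq, Real.sqrt_mul zero_le_two, div_pow]
  field_simp

/-- The probability that `j + 1` independent uniform choices among `k` objects are distinct. -/
noncomputable def distinctProb (k j : ℕ) : ℝ := ∏ i ∈ Finset.range (j + 1), (1 - (i : ℝ) / k)

theorem distinctProb_eq_zero {k j : ℕ} (hk : 0 < k) (h : k ≤ j) : distinctProb k j = 0 := by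
  refine Finset.prod_eq_zero (Finset.mem_range.2 (Nat.lt_succ_of_le h)) ?_
  have : (k : ℝ) ≠ 0 := by positivity
  simp [this]

theorem sum_range_succ_cast_div (j : ℕ) (c : ℝ) :
    ∑ i ∈ Finset.range (j + 1), (i : ℝ) / c = j * (j + 1) / (2 * c) := by
  rw [← Finset.sum_div]
  have h : ∑ i ∈ Finset.range (j + 1), (i : ℝ) = j * (j + 1) / 2 := by
    have := Finset.sum_range_id_mul_two (j + 1)
    have h' : ((∑ i ∈ Finset.range (j + 1), i : ℕ) : ℝ) * 2 = (j + 1) * j := by exact_mod_cast this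
    push_cast at h'
    linarith
  rw [h, div_div]

theorem one_sub_div_nonneg {k j i : ℕ} (h : j < k) (hi : i ∈ Finset.range (j + 1)) :
    0 ≤ 1 - (i : ℝ) / k := by
  have hk : (0 : ℝ) < k := by exact_mod_cast (Nat.zero_le j).trans_lt h
  have : (i : ℝ) ≤ k := by
    have := Finset.mem_range.1 hi
    exact_mod_cast (show i ≤ k by omega)
  rw [sub_nonneg, div_le_one hk]
  exact this

theorem distinctProb_le {k j : ℕ} (h : j < k) :
    distinctProb k j ≤ Real.exp (-(j * (j + 1) / (2 * k))) := by
  rw [← sum_range_succ_cast_div, ← Finset.sum_neg_distrib, Real.exp_sum]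
  exact Finset.prod_le_prod (fun i hi => one_sub_div_nonneg h hi)
    fun i _ => Real.one_sub_le_exp_neg _

theorem distinctProb_nonneg {k j : ℕ} (hk : 0 < k) : 0 ≤ distinctProb k j := by
  rcases lt_or_ge j k with h | h
  · exact Finset.prod_nonneg fun i hi => one_sub_div_nonneg h hi
  · rw [distinctProb_eq_zero hk h]

/-- Uses log(1 - u) ≥ -u/(1 - u) for u = i/k, with the denominator bounded below by 1 - j/k. -/
theorem le_distinctProb {k j : ℕ} (h : j < k) :
    Real.exp (-(j * (j + 1) / (2 * k) / (1 - j / k))) ≤ distinctProb k j := by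
  have hk : (0 : ℝ) < k := by exact_mod_cast (Nat.zero_le j).trans_lt h
  have hjk : (0 : ℝ) < 1 - j / k := by
    rw [sub_pos, div_lt_one hk]; exact_mod_cast h
  rw [← sum_range_succ_cast_div, Finset.sum_div, ← Finset.sum_neg_distrib, Real.exp_sum]
  refine Finset.prod_le_prod (fun i _ => (Real.exp_pos _).le) fun i hi => ?_
  have hij : (i : ℝ) ≤ j := by
    have := Finset.mem_range.1 hi
    exact_mod_cast (show i ≤ j by omega)
  have hle : 1 - (j : ℝ) / k ≤ 1 - (i : ℝ) / k := by gcongr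
  have hik : (0 : ℝ) < 1 - (i : ℝ) / k := hjk.trans_le hle
  rw [← Real.le_log_iff_exp_le hik]
  refine le_trans ?_ (Real.one_sub_inv_le_log_of_pos hik)
  have h1 : 1 - (1 - (i : ℝ) / k)⁻¹ = -((i : ℝ) / k / (1 - (i : ℝ) / k)) := by
    rw [div_eq_mul_inv ((i : ℝ) / k)]
    linear_combination (-1) * mul_inv_cancel₀ hik.ne'
  rw [h1]
  gcongr

theorem tendsto_floor_sqrt_div {t : ℝ} (ht : 0 ≤ t) :
    Tendsto (fun k : ℕ => (⌊√(k : ℝ) * t⌋₊ : ℝ) / √(k : ℝ)) atTop (𝓝 t) := by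
  have := (tendsto_nat_floor_mul_div_atTop ht).comp
    (Real.tendsto_sqrt_atTop.comp tendsto_natCast_atTop_atTop)
  simpa [Function.comp_def, mul_comm] using this

theorem tendsto_inv_sqrt_nat : Tendsto (fun k : ℕ => (√(k : ℝ))⁻¹) atTop (𝓝 0) :=
  tendsto_inv_atTop_zero.comp (Real.tendsto_sqrt_atTop.comp tendsto_natCast_atTop_atTop)

theorem tendsto_distinctProb {t : ℝ} (ht : 0 ≤ t) :
    Tendsto (fun k : ℕ => distinctProb k ⌊√(k : ℝ) * t⌋₊) atTop
      (𝓝 (Real.exp (-(1 / 2) * t ^ 2))) := by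
  have h1 := tendsto_floor_sqrt_div ht
  have h0 := tendsto_inv_sqrt_nat
  have h2 : Tendsto (fun k : ℕ => (⌊√(k : ℝ) * t⌋₊ : ℝ) * (⌊√(k : ℝ) * t⌋₊ + 1) / (2 * k)) atTop
      (𝓝 (1 / 2 * t ^ 2)) := by
    have h := ((h1.pow 2).add (h1.mul h0)).const_mul (1 / 2)
    rw [mul_zero, add_zero] at h
    refine h.congr' ?_
    filter_upwards [eventually_gt_atTop 0] with k hk
    have hk' : (0 : ℝ) < k := by exact_mod_cast hk
    have hs := Real.sqrt_pos.2 hk'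
    have hsq := Real.sq_sqrt hk'.le
    field_simp
    rw [hsq]
    ring
  have h3 : Tendsto (fun k : ℕ => (⌊√(k : ℝ) * t⌋₊ : ℝ) / k) atTop (𝓝 0) := by
    have h := h1.mul h0
    rw [mul_zero] at h
    refine h.congr' ?_
    filter_upwards [eventually_gt_atTop 0] with k hk
    have hk' : (0 : ℝ) < k := by exact_mod_cast hk
    rw [← div_eq_mul_inv, div_div, Real.mul_self_sqrt hk'.le]
  have h4 : Tendsto (fun k : ℕ => 1 - (⌊√(k : ℝ) * t⌋₊ : ℝ) / k) atTop (𝓝 1) := by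
    simpa using h3.const_sub 1
  have hup := (Real.continuous_exp.tendsto _).comp h2.neg
  have hlo := (Real.continuous_exp.tendsto _).comp (h2.div h4 one_ne_zero).neg
  rw [div_one] at hlo
  rw [neg_mul]
  have hlt : ∀ᶠ k : ℕ in atTop, ⌊√(k : ℝ) * t⌋₊ < k := by
    filter_upwards [h3.eventually_lt_const one_pos, eventually_gt_atTop 0] with k hk hk0
    have hk' : (0 : ℝ) < k := by exact_mod_cast hk0
    rw [div_lt_one hk'] at hk
    exact_mod_cast hk
  refine tendsto_of_tendsto_of_tendsto_of_le_of_le' hlo hup ?_ ?_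
  · filter_upwards [hlt] with k hk using le_distinctProb hk
  · filter_upwards [hlt] with k hk using distinctProb_le hk

theorem distinctProb_bound {k : ℕ} (hk : 0 < k) {t : ℝ} (ht : 0 ≤ t) :
    distinctProb k ⌊√(k : ℝ) * t⌋₊ ≤ Real.exp (1 / 4) * Real.exp (-(1 / 4) * t ^ 2) := by
  have hk' : (1 : ℝ) ≤ k := by exact_mod_cast hk
  rcases lt_or_ge ⌊√(k : ℝ) * t⌋₊ k with h | h
  · refine (distinctProb_le h).trans ?_
    rw [← Real.exp_add, Real.exp_le_exp]
    set j := ⌊√(k : ℝ) * t⌋₊ with hj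
    have hs : 1 ≤ √(k : ℝ) := Real.one_le_sqrt.2 hk'
    have hsq : √(k : ℝ) ^ 2 = k := Real.sq_sqrt (by linarith)
    have hlt : √(k : ℝ) * t < j + 1 := Nat.lt_floor_add_one _
    have hj0 : (0 : ℝ) ≤ j := by positivity
    have hst : 0 ≤ √(k : ℝ) * t := by positivity
    -- From j + 1 > √k t and √k ≤ k. The final constants 1/4 come from (t - 1)² ≥ 0, which gives (t²
    -- - t)/2 ≥ t²/4 - 1/4.
    have key : k * (t ^ 2 - t) ≤ (j : ℝ) * (j + 1) := by
      have h1 : (√(k : ℝ) * t) * (√(k : ℝ) * t - 1) ≤ (j : ℝ) * (j + 1) := by nlinarith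
      have h2 : √(k : ℝ) * t ≤ k * t := by
        have : √(k : ℝ) ≤ k := by nlinarith
        gcongr
      nlinarith
    have h3 : (t ^ 2 - t) / 2 ≤ (j : ℝ) * (j + 1) / (2 * k) := by
      rw [div_le_div_iff₀ (by norm_num) (by positivity)]
      linarith
    nlinarith [sq_nonneg (t / 2 - 1 / 2)]
  · rw [distinctProb_eq_zero hk h]
    positivity

/-- At j ≈ t√k the summand tends to exp(-t²/2). Terms with j ≥ k vanish, so the step function may be
integrated over the whole half-line. -/
theorem tendsto_sum_distinctProb :
    Tendsto (fun k : ℕ => (∑ j ∈ Finset.range k, distinctProb k j) / √(k : ℝ)) atTop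
      (𝓝 (√(Real.pi / (1 / 2)) / 2)) := by
  rw [← integral_gaussian_Ioi (1 / 2)]
  have hsum : ∀ᶠ k : ℕ in atTop, ∫ t in Ioi (0 : ℝ), distinctProb k ⌊√(k : ℝ) * t⌋₊ =
      (∑ j ∈ Finset.range k, distinctProb k j) / √(k : ℝ) := by
    filter_upwards [eventually_gt_atTop 0] with k hk
    have hk' : (0 : ℝ) < k := by exact_mod_cast hk
    have hs := Real.sqrt_pos.2 hk'
    rw [← integral_step (distinctProb k) hs k, intervalIntegral.integral_of_le (by positivity)]
    refine (setIntegral_eq_of_subset_of_forall_sdiff_eq_zero measurableSet_Ioi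
      (fun t ht => ht.1) fun t ht => ?_)
    have h1 : (k : ℝ) / √(k : ℝ) < t := by
      by_contra! hle
      exact ht.2 ⟨ht.1, hle⟩
    rw [div_lt_iff₀' hs] at h1
    exact distinctProb_eq_zero hk (Nat.le_floor h1.le)
  refine Tendsto.congr' hsum ?_
  refine tendsto_integral_filter_of_dominated_convergence
    (fun t => Real.exp (1 / 4) * Real.exp (-(1 / 4) * t ^ 2)) ?_ ?_ ?_ ?_
  · exact Eventually.of_forall fun k =>
      (measurable_comp_floor (distinctProb k) _).aestronglyMeasurable
  · filter_upwards [eventually_gt_atTop 0] with k hk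
    filter_upwards [ae_restrict_mem measurableSet_Ioi] with t ht
    rw [Real.norm_eq_abs, abs_of_nonneg (distinctProb_nonneg hk)]
    exact distinctProb_bound hk (le_of_lt ht)
  · exact ((integrable_exp_neg_mul_sq (by norm_num)).const_mul _).integrableOn
  · filter_upwards [ae_restrict_mem measurableSet_Ioi] with t ht
    exact tendsto_distinctProb (le_of_lt ht)

theorem distinctProb_eq {k j : ℕ} (h : j < k) :
    (k : ℝ) ^ k / k.factorial * distinctProb k j =
      (k : ℝ) ^ (k - 1 - j) / (k - 1 - j).factorial := by
  have hk : (0 : ℝ) < k := by exact_mod_cast (Nat.zero_le j).trans_lt h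
  induction j with
  | zero =>
    obtain ⟨l, rfl⟩ : ∃ l, k = l + 1 := ⟨k - 1, by omega⟩
    simp only [distinctProb, zero_add, Finset.range_one, Finset.prod_singleton, Nat.cast_zero,
      zero_div, sub_zero, mul_one, Nat.add_sub_cancel, Nat.factorial_succ, Nat.sub_zero]
    push_cast at hk ⊢
    field_simp
    ring
  | succ j ih =>
    have ih' := ih (by omega)
    have hstep : distinctProb k (j + 1) = distinctProb k j * (1 - ((j + 1 : ℕ) : ℝ) / k) :=
      Finset.prod_range_succ _ _
    obtain ⟨l, hl⟩ : ∃ l, k - 1 - j = l + 1 := ⟨k - 1 - j - 1, by omega⟩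
    have hl' : k - 1 - (j + 1) = l := by omega
    have hkl : (1 - ((j + 1 : ℕ) : ℝ) / k) = (l + 1) / k := by
      have : (k : ℝ) = l + 1 + (j + 1) := by exact_mod_cast (show k = l + 1 + (j + 1) by omega)
      rw [eq_div_iff hk.ne', sub_mul, div_mul_cancel₀ _ hk.ne']
      push_cast
      linarith
    rw [hstep, ← mul_assoc, ih', hl, hl', hkl, Nat.factorial_succ]
    push_cast
    field_simp
    ring

/-- Reversing Σ_{m<k} k^m/m! factors it as k^k/k! times the sum of `distinctProb`. The limit is then
(1/√(2π)) · √(π/2) = 1/2. -/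
theorem tendsto_mapping_connected :
    Tendsto (fun k : ℕ =>
      (k : ℝ) * (connectedCount (HasOutDegree 1) k / (k.factorial * Real.exp 1 ^ k) : ℝ)) atTop
      (𝓝 (1 / 2)) := by
  have h := tendsto_mapping_total.mul tendsto_sum_distinctProb
  have hlim : 1 / (√Real.pi * √2) * (√(Real.pi / (1 / 2)) / 2) = 1 / 2 := by
    rw [show Real.pi / (1 / 2) = Real.pi * 2 by ring, Real.sqrt_mul Real.pi_pos.le]
    field_simp
  rw [hlim] at h
  refine h.congr' ?_
  filter_upwards [eventually_gt_atTop 0] with k hk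
  have hk' : (0 : ℝ) < k := by exact_mod_cast hk
  have hs := Real.sqrt_pos.2 hk'
  have h1 : (k : ℝ) ^ k / k.factorial * ∑ j ∈ Finset.range k, distinctProb k j =
      (k : ℝ) * (connectedCount (HasOutDegree 1) k / k.factorial) := by
    rw [connectedCount_map, ← Finset.sum_range_reflect (fun m => (k : ℝ) ^ m / m.factorial),
      Finset.mul_sum]
    exact Finset.sum_congr rfl fun j hj => distinctProb_eq (Finset.mem_range.1 hj)
  rw [← div_div, ← div_div, ← mul_div_assoc _ _ (Real.exp 1 ^ k), ← h1]
  field_simp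

theorem tendsto_mapping_largest {x : ℝ} (hx : x ∈ Icc (1 / 2 : ℝ) 1) :
    Tendsto (fun n : ℕ => uniformProb (fun f : Mapping n => x * (n : ℝ) < (Mapping.largest f : ℝ)))
      atTop (𝓝 (∫ y in x..1, 1 / (2 * y * Real.sqrt (1 - y)))) := by
  have hp := tendsto_mapping_total
  have h := tendsto_uniformProb_largestComponent (HasOutDegree.isDecomposable 1)
    (Real.exp_pos 1) (A := 1 / (√Real.pi * √2)) (by positivity)
    (by simpa only [totalCount_map, Nat.cast_pow] using hp) tendsto_mapping_connected hx
  refine h.congr fun n => (uniformProb_congr (mapEquiv (Fin n)) fun f => ?_).symm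
  rfl

section

/-! ### Permutations -/

/-- Every element is related to exactly one element, on either side. -/
def IsPermRel (V : Type) (r : V → V → Prop) : Prop :=
  HasOutDegree 1 V r ∧ HasOutDegree 1 V (fun a b => r b a)

theorem IsPermRel.isDecomposable : IsDecomposable IsPermRel :=
  (HasOutDegree.isDecomposable 1).and (HasOutDegree.isDecomposable 1).flip

/-- A permutation as a relation. -/
noncomputable def permEquiv (V : Type) : Equiv.Perm V ≃ {r : V → V → Prop // IsPermRel V r} :=
  Equiv.ofBijective (fun σ => ⟨fun a b => σ a = b, fun a => by simp, fun a => by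
      rw [Set.ncard_eq_one]
      exact ⟨σ.symm a, by ext b; simp [Equiv.eq_symm_apply]⟩⟩) <| by
    constructor
    · intro σ τ h
      ext a
      have := congrFun (congrFun (congrArg Subtype.val h) a) (τ a)
      simpa using this
    · rintro ⟨r, hr, hr'⟩
      obtain ⟨f, hf⟩ := (mapEquiv V).surjective ⟨r, hr⟩
      have hfr : (fun a b => f a = b) = r := congrArg Subtype.val hf
      subst hfr
      have hbij : Function.Bijective f := by
        rw [Function.bijective_iff_existsUnique]
        intro b
        obtain ⟨a, ha⟩ := Set.ncard_eq_one.1 (hr' b)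
        have h : ∀ c, f c = b ↔ c = a := fun c => by
          have : c ∈ {c | f c = b} ↔ c = a := by rw [ha]; rfl
          simpa using this
        exact ⟨a, (h a).2 rfl, fun c hc => (h c).1 hc⟩
      exact ⟨Equiv.ofBijective f hbij, rfl⟩

theorem totalCount_perm (n : ℕ) : totalCount IsPermRel n = n.factorial := by
  rw [totalCount, ← Nat.card_congr (permEquiv (Fin n)), Nat.card_perm]
  simp

/-- All normalized totals are 1, so the recurrence reads n = Σ_{k≤n} k c_k/k! and forces each term
with k ≥ 1 to be 1. -/
theorem connectedCount_perm {k : ℕ} (hk : 0 < k) :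
    (k : ℝ) * (connectedCount IsPermRel k / k.factorial) = 1 := by
  have h := eq_of_convolution_eq
    (t := fun k => (k : ℝ) * (connectedCount IsPermRel k / k.factorial))
    (s := fun k => if k = 0 then 0 else 1) (b := fun _ => 1) (by simp) (fun n => ?_) k
  · simpa [hk.ne'] using h
  · have h := normalized_recurrence IsPermRel.isDecomposable n
    have h1 : ∀ n : ℕ, (totalCount IsPermRel n : ℝ) / n.factorial = 1 := fun n => by
      rw [totalCount_perm, div_self (by positivity)]
    simp only [h1] at h
    rw [← h, Finset.sum_range_succ']
    simp

/-! ### Orientations of connected `2`-regular graphs -/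

variable {V : Type}

/-- The undirected graph of a permutation. -/
def permGraph (σ : Equiv.Perm V) : SimpleGraph V := SimpleGraph.fromRel fun a b => σ a = b

theorem permGraph_adj {σ : Equiv.Perm V} {a b : V} :
    (permGraph σ).Adj a b ↔ a ≠ b ∧ (σ a = b ∨ σ b = a) := by
  simp [permGraph]

theorem permGraph_inv (σ : Equiv.Perm V) : permGraph σ⁻¹ = permGraph σ := by
  ext a b
  simp only [permGraph_adj, Equiv.Perm.inv_eq_iff_eq]
  grind

theorem mem_of_connected {G : SimpleGraph V} (hG : G.Connected) {S : Set V}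
    (hS : ∀ a b, G.Adj a b → a ∈ S → b ∈ S) {v : V} (hv : v ∈ S) (w : V) : w ∈ S :=
  mem_of_reachable hS (hG.preconnected v w) hv

theorem apply_apply_ne_of_connected [Finite V] {σ : Equiv.Perm V} (hσ : (permGraph σ).Connected)
    (hV : 3 ≤ Nat.card V) (v : V) : σ (σ v) ≠ v := by
  intro h
  have hall : ∀ w, w ∈ ({v, σ v} : Set V) := by
    refine mem_of_connected hσ (fun a b hab ha => ?_) (v := v) (by simp)
    rw [permGraph_adj] at hab
    simp only [mem_insert_iff, mem_singleton_iff] at ha ⊢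
    have hinj := σ.injective
    rcases ha with rfl | rfl
    · rcases hab.2 with h1 | h1
      · exact Or.inr h1.symm
      · exact Or.inr (hinj (h1.trans h.symm))
    · rcases hab.2 with h1 | h1
      · exact Or.inl (h1.symm.trans h)
      · exact Or.inl (hinj h1)
  have huniv : ({v, σ v} : Set V) = univ := eq_univ_of_forall hall
  have := Set.ncard_insert_le v {σ v}
  rw [huniv, Set.ncard_univ, Set.ncard_singleton] at this
  omega

/-- Every vertex of the graph has exactly two neighbors. -/
def IsTwoRegular (G : SimpleGraph V) : Prop := ∀ v, (G.neighborSet v).ncard = 2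

theorem IsTwoRegular.eq_or_eq {G : SimpleGraph V} (hG : IsTwoRegular G) {v a b c : V}
    (ha : G.Adj v a) (hb : G.Adj v b) (hab : a ≠ b) (hc : G.Adj v c) : c = a ∨ c = b := by
  obtain ⟨x, y, _, h⟩ := Set.ncard_eq_two.1 (hG v)
  have key : ∀ d, G.Adj v d ↔ d = x ∨ d = y := fun d => by
    rw [← SimpleGraph.mem_neighborSet, h]; simp
  rw [key] at ha hb hc
  grind

theorem IsTwoRegular.exists_other {G : SimpleGraph V} (hG : IsTwoRegular G) (v w : V) :
    ∃ u, G.Adj v u ∧ u ≠ w := by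
  obtain ⟨x, y, hxy, h⟩ := Set.ncard_eq_two.1 (hG v)
  have key : ∀ d, G.Adj v d ↔ d = x ∨ d = y := fun d => by
    rw [← SimpleGraph.mem_neighborSet, h]; simp
  by_cases hx : x = w
  · exact ⟨y, (key y).2 (Or.inr rfl), fun hy => hxy (hx.trans hy.symm)⟩
  · exact ⟨x, (key x).2 (Or.inl rfl), hx⟩

theorem permGraph_neighborSet {σ : Equiv.Perm V} (h : ∀ v, σ (σ v) ≠ v) (v : V) :
    (permGraph σ).neighborSet v = {σ v, σ.symm v} := by
  have hne : ∀ v, σ v ≠ v := fun v hv => h v (by rw [hv, hv])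
  ext w
  rw [SimpleGraph.mem_neighborSet, permGraph_adj]
  simp only [mem_insert_iff, mem_singleton_iff, Equiv.eq_symm_apply]
  have := hne v
  have := hne w
  grind

theorem apply_ne_symm_apply {σ : Equiv.Perm V} (h : ∀ v, σ (σ v) ≠ v) (v : V) :
    σ v ≠ σ.symm v := by
  rw [Ne, Equiv.eq_symm_apply]
  exact h v

theorem isTwoRegular_permGraph {σ : Equiv.Perm V} (h : ∀ v, σ (σ v) ≠ v) :
    IsTwoRegular (permGraph σ) := fun v => by
  rw [permGraph_neighborSet h, Set.ncard_pair (apply_ne_symm_apply h v)]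

/-- Both permutations have the same neighbor pair at each vertex, so agreement of images and of
preimages are equivalent, and agreement spreads along edges. -/
theorem permGraph_injective_of_apply_eq {σ τ : Equiv.Perm V} (hσ : ∀ v, σ (σ v) ≠ v)
    (hτ : ∀ v, τ (τ v) ≠ v) (hστ : permGraph σ = permGraph τ) (hconn : (permGraph σ).Connected)
    {v : V} (hv : σ v = τ v) : σ = τ := by
  have hN : ∀ v, ({σ v, σ.symm v} : Set V) = {τ v, τ.symm v} := fun v => by
    rw [← permGraph_neighborSet hσ, ← permGraph_neighborSet hτ, hστ]
  have hsymm : ∀ a, σ a = τ a → σ.symm a = τ.symm a := by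
    intro a ha
    have h1 : σ.symm a ∈ ({τ a, τ.symm a} : Set V) := by rw [← hN]; simp
    rcases h1 with h1 | h1
    · exact absurd (ha.trans h1.symm) (apply_ne_symm_apply hσ a)
    · exact h1
  have happ : ∀ a, σ.symm a = τ.symm a → σ a = τ a := by
    intro a ha
    have h1 : σ a ∈ ({τ a, τ.symm a} : Set V) := by rw [← hN]; simp
    rcases h1 with h1 | h1
    · exact h1
    · exact absurd (h1.trans ha.symm) (apply_ne_symm_apply hσ a)
  have hall : ∀ w, w ∈ {w | σ w = τ w} := by
    refine mem_of_connected hconn (fun a b hab ha => ?_) (v := v) hv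
    rw [permGraph_adj] at hab
    simp only [mem_ofPred_eq] at ha ⊢
    rcases hab.2 with h1 | h1
    · refine happ b ?_
      rw [← h1, Equiv.symm_apply_apply, ha, Equiv.symm_apply_apply]
    · have h2 := hsymm a ha
      rw [← h1, Equiv.symm_apply_apply, h1] at h2
      rw [h1, h2, Equiv.apply_symm_apply]
  exact Equiv.ext hall

/-- If f u = f w with u ≠ w, these are the only neighbors of f u, so f (f u) would step back to one
of them. -/
theorem exists_perm_of_orientation {G : SimpleGraph V} (hG : IsTwoRegular G) {f : V → V}
    [Finite V] (hadj : ∀ v, G.Adj v (f v)) (hne : ∀ v, f (f v) ≠ v) :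
    ∃ σ : Equiv.Perm V, permGraph σ = G ∧ ∀ v, σ (σ v) ≠ v := by
  have hinj : Function.Injective f := by
    intro u w huw
    by_contra hcon
    have h1 : G.Adj (f u) w := huw ▸ (hadj w).symm
    rcases hG.eq_or_eq (hadj u).symm h1 hcon (hadj (f u)) with h | h
    · exact hne u h
    · exact hne w (huw ▸ h)
  refine ⟨Equiv.ofBijective f (Finite.injective_iff_bijective.1 hinj), ?_, hne⟩
  set σ := Equiv.ofBijective f (Finite.injective_iff_bijective.1 hinj) with hσ
  have hσf : ∀ v, σ v = f v := fun v => rfl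
  ext a b
  rw [permGraph_adj]
  constructor
  · rintro ⟨_, h | h⟩
    · exact h ▸ hadj a
    · exact h ▸ (hadj b).symm
  · intro hab
    refine ⟨hab.ne, ?_⟩
    have h1 : G.Adj a (σ.symm a) := by
      have := hadj (σ.symm a)
      rw [← hσf, Equiv.apply_symm_apply] at this
      exact this.symm
    rcases hG.eq_or_eq (hadj a) h1 (apply_ne_symm_apply (σ := σ) hne a) hab with h | h
    · exact Or.inl h.symm
    · exact Or.inr (by rw [h, Equiv.apply_symm_apply])

/-! ### Non-backtracking walks on darts -/

section Darts

variable {G : SimpleGraph V} (hG : IsTwoRegular G)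

/-- The dart that continues `d` without turning back. -/
noncomputable def nextDart (d : G.Dart) : G.Dart :=
  ⟨(d.snd, (hG.exists_other d.snd d.fst).choose), (hG.exists_other d.snd d.fst).choose_spec.1⟩

theorem nextDart_snd_ne (d : G.Dart) : (nextDart hG d).snd ≠ d.fst :=
  (hG.exists_other d.snd d.fst).choose_spec.2

theorem eq_nextDart {d e : G.Dart} (h1 : e.fst = d.snd) (h2 : e.snd ≠ d.fst) :
    e = nextDart hG d := by
  ext
  · exact h1
  · have ha : G.Adj d.snd e.snd := h1 ▸ e.adj
    have hb : G.Adj d.snd (nextDart hG d).snd := (nextDart hG d).adj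
    rcases hG.eq_or_eq d.adj.symm hb (nextDart_snd_ne hG d).symm ha with h | h
    · exact absurd h h2
    · exact h

theorem nextDart_symm_nextDart (d : G.Dart) : nextDart hG (nextDart hG d).symm = d.symm :=
  (eq_nextDart hG rfl (nextDart_snd_ne hG d).symm).symm

/-- Continuing a dart, as a permutation of the darts. -/
noncomputable def dartPerm : Equiv.Perm G.Dart where
  toFun := nextDart hG
  invFun d := (nextDart hG d.symm).symm
  left_inv d := by
    simp only
    rw [nextDart_symm_nextDart, SimpleGraph.Dart.symm_symm]
  right_inv d := by
    rw [nextDart_symm_nextDart, SimpleGraph.Dart.symm_symm]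

/-- If s + 2 steps reverse d, then removing the first and last shows that s steps reverse the dart
after d. This descends to s = 0 or 1, where it is impossible. -/
theorem dartPerm_pow_ne_symm (s : ℕ) : ∀ d : G.Dart, (dartPerm hG ^ s) d ≠ d.symm := by
  induction s using Nat.twoStepInduction with
  | zero => exact fun d h => d.symm_ne h.symm
  | one =>
    intro d h
    rw [pow_one] at h
    exact nextDart_snd_ne hG d (congrArg (fun e : G.Dart => e.snd) h)
  | more s ih _ =>
    intro d h
    refine ih (dartPerm hG d) ((dartPerm hG).injective ?_)
    have h1 : dartPerm hG (dartPerm hG d).symm = d.symm := nextDart_symm_nextDart hG d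
    rw [h1, ← h, pow_succ, pow_succ']
    rfl

theorem not_sameCycle_symm [Finite V] (d : G.Dart) : ¬ (dartPerm hG).SameCycle d d.symm := by
  have : Finite G.Dart := Finite.of_injective _ SimpleGraph.Dart.toProd_injective
  intro h
  obtain ⟨s, hs⟩ := h.exists_nat_pow_eq
  exact dartPerm_pow_ne_symm hG s d hs

end Darts

/-- The cycle of one dart under continuation leaves every vertex, by connectedness, and leaves it
only once, since otherwise it would contain a dart and its reverse. Its darts orient G. -/
theorem exists_orientation [Finite V] {G : SimpleGraph V} (hG : IsTwoRegular G)
    (hconn : G.Connected) : ∃ σ : Equiv.Perm V, permGraph σ = G ∧ ∀ v, σ (σ v) ≠ v := by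
  classical
  obtain ⟨v₀⟩ := hconn.nonempty
  obtain ⟨w₀, hw₀, _⟩ := hG.exists_other v₀ v₀
  set φ := dartPerm hG with hφ
  let d₀ : G.Dart := ⟨(v₀, w₀), hw₀⟩
  have hprev : ∀ d e : G.Dart, e.snd = d.fst → e.fst ≠ d.snd → φ e = d := fun d e h1 h2 =>
    (eq_nextDart hG h1.symm h2.symm).symm
  have hcover : ∀ v, v ∈ {v | ∃ d, φ.SameCycle d₀ d ∧ d.fst = v} := by
    refine mem_of_connected hconn ?_ (v := v₀) ⟨d₀, Equiv.Perm.SameCycle.refl _ _, rfl⟩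
    rintro _ a hadj ⟨d, hd, rfl⟩
    by_cases ha : a = d.snd
    · exact ⟨φ d, Equiv.Perm.sameCycle_apply_right.2 hd, ha.symm⟩
    · refine ⟨⟨(a, d.fst), hadj.symm⟩, ?_, rfl⟩
      rw [← Equiv.Perm.sameCycle_apply_right, hprev d _ rfl ha]
      exact hd
  choose D hD hDfst using hcover
  have huniq : ∀ d e : G.Dart, φ.SameCycle d₀ d → φ.SameCycle d₀ e → d.fst = e.fst → d = e := by
    intro d e hd he hde
    by_contra hne
    have hsnd : e.snd ≠ d.snd := fun h => hne (by ext; exacts [hde, h.symm])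
    have h1 : φ e.symm = d := hprev d e.symm hde.symm hsnd
    refine not_sameCycle_symm hG e (he.symm.trans ?_)
    rw [← Equiv.Perm.sameCycle_apply_right, h1]
    exact hd
  refine exists_perm_of_orientation hG (f := fun v => (D v).snd) (fun v => ?_) fun v => ?_
  · have := (D v).adj
    rwa [hDfst] at this
  · have h1 : D (D v).snd = φ (D v) :=
      huniq _ _ (hD _) (Equiv.Perm.sameCycle_apply_right.2 (hD v)) (hDfst _)
    simp only [h1]
    have := nextDart_snd_ne hG (D v)
    rwa [hDfst] at this

end

/-! ### Counting `2`-regular graphs -/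

theorem ncard_orientations {V : Type} [Finite V] (hV : 3 ≤ Nat.card V) {G : SimpleGraph V}
    (hG : IsTwoRegular G) (hconn : G.Connected) :
    Nat.card {σ : Equiv.Perm V // permGraph σ = G} = 2 := by
  obtain ⟨σ, rfl, hσ⟩ := exists_orientation hG hconn
  obtain ⟨v⟩ := hconn.nonempty
  have hset : {τ : Equiv.Perm V | permGraph τ = permGraph σ} = {σ, σ⁻¹} := by
    ext τ
    simp only [mem_ofPred_eq, mem_insert_iff, mem_singleton_iff]
    constructor
    · intro h
      have hτ : ∀ v, τ (τ v) ≠ v := apply_apply_ne_of_connected (h ▸ hconn) hV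
      have hσ' : ∀ v, σ⁻¹ (σ⁻¹ v) ≠ v :=
        apply_apply_ne_of_connected ((permGraph_inv σ).symm ▸ hconn) hV
      have hmem : τ v ∈ ({σ v, σ.symm v} : Set V) := by
        rw [← permGraph_neighborSet hσ, ← h, permGraph_neighborSet hτ]
        simp
      rcases hmem with h1 | h1
      · exact Or.inl (permGraph_injective_of_apply_eq hτ hσ h (h ▸ hconn) h1)
      · exact Or.inr (permGraph_injective_of_apply_eq hτ hσ' (h.trans (permGraph_inv σ).symm)
          (h ▸ hconn) h1)
    · rintro (rfl | rfl)
      · rfl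
      · exact permGraph_inv σ
  have hne : σ ≠ σ⁻¹ := fun h => apply_ne_symm_apply hσ v (congrArg (fun τ => τ v) h)
  have := Set.ncard_pair hne
  rwa [← hset, ← Nat.card_coe_set_eq] at this

theorem card_connected_perm {V : Type} [Finite V] (hV : 3 ≤ Nat.card V) :
    Nat.card {σ : Equiv.Perm V // (permGraph σ).Connected} =
      Nat.card {G : SimpleGraph V // IsTwoRegular G ∧ G.Connected} * 2 := by
  classical
  have := Fintype.ofFinite V
  let F : {σ : Equiv.Perm V // (permGraph σ).Connected} →
      {G : SimpleGraph V // IsTwoRegular G ∧ G.Connected} := fun σ =>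
    ⟨permGraph σ.1, isTwoRegular_permGraph (apply_apply_ne_of_connected σ.2 hV), σ.2⟩
  have hfib : ∀ G, Nat.card {σ // F σ = G} = 2 := by
    intro G
    rw [← ncard_orientations hV G.2.1 G.2.2]
    refine Nat.card_congr ⟨fun σ => ⟨σ.1.1, congrArg Subtype.val σ.2⟩,
      fun σ => ⟨⟨σ.1, σ.2.symm ▸ G.2.2⟩, Subtype.ext σ.2⟩, fun _ => rfl, fun _ => rfl⟩
  have hfin : Finite {G : SimpleGraph V // IsTwoRegular G ∧ G.Connected} := inferInstance
  have := Fintype.ofFinite {G : SimpleGraph V // IsTwoRegular G ∧ G.Connected}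
  rw [← Nat.card_congr (Equiv.sigmaFiberEquiv F), Nat.card_sigma,
    Finset.sum_congr rfl fun G _ => hfib G, Finset.sum_const, Finset.card_univ, smul_eq_mul,
    Nat.card_eq_fintype_card]

/-- The adjacency relations of `2`-regular graphs. -/
def IsTwoRegularRel (V : Type) (r : V → V → Prop) : Prop :=
  (∀ a b, r a b → r b a) ∧ (∀ a, ¬ r a a) ∧ HasOutDegree 2 V r

theorem IsTwoRegularRel.isDecomposable : IsDecomposable IsTwoRegularRel :=
  isDecomposable_symmetric.and (isDecomposable_irreflexive.and (HasOutDegree.isDecomposable 2))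

theorem fromRel_adj_self {V : Type} (G : SimpleGraph V) : SimpleGraph.fromRel G.Adj = G := by
  ext a b
  simp only [SimpleGraph.fromRel_adj]
  exact ⟨fun h => h.2.elim id fun h => h.symm, fun h => ⟨h.ne, Or.inl h⟩⟩

/-- A `2`-regular graph as a relation. -/
def twoRegularEquiv (V : Type) :
    {G : SimpleGraph V // IsTwoRegular G} ≃ {r : V → V → Prop // IsTwoRegularRel V r} where
  toFun G := ⟨G.1.Adj, fun _ _ h => h.symm, fun _ => G.1.irrefl, G.2⟩
  invFun r := ⟨⟨r.1, ⟨r.2.1⟩, ⟨r.2.2.1⟩⟩, r.2.2.2⟩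
  left_inv _ := rfl
  right_inv _ := rfl

theorem connectedCount_twoRegular_mul_two {k : ℕ} (hk : 3 ≤ k) :
    connectedCount IsTwoRegularRel k * 2 = connectedCount IsPermRel k := by
  have h := card_connected_perm (V := Fin k) (by simpa using hk)
  have h1 : connectedCount IsPermRel k =
      Nat.card {σ : Equiv.Perm (Fin k) // (permGraph σ).Connected} := by
    rw [connectedCount, ← Nat.card_congr (Equiv.subtypeSubtypeEquivSubtypeInter
      (IsPermRel (Fin k)) (fun r => (SimpleGraph.fromRel r).Connected))]
    exact (Nat.card_congr ((permEquiv (Fin k)).subtypeEquiv fun σ => Iff.rfl)).symm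
  have h2 : connectedCount IsTwoRegularRel k =
      Nat.card {G : SimpleGraph (Fin k) // IsTwoRegular G ∧ G.Connected} := by
    rw [connectedCount, ← Nat.card_congr (Equiv.subtypeSubtypeEquivSubtypeInter
      (IsTwoRegularRel (Fin k)) (fun r => (SimpleGraph.fromRel r).Connected)),
      ← Nat.card_congr (Equiv.subtypeSubtypeEquivSubtypeInter
      (IsTwoRegular (V := Fin k)) (fun G => G.Connected))]
    refine (Nat.card_congr ((twoRegularEquiv (Fin k)).subtypeEquiv fun G => ?_)).symm
    change _ ↔ (SimpleGraph.fromRel G.1.Adj).Connected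
    rw [fromRel_adj_self]
  rw [h1, h2, h]

theorem connectedCount_twoRegular {k : ℕ} (hk : 3 ≤ k) :
    (k : ℝ) * (connectedCount IsTwoRegularRel k / k.factorial) = 1 / 2 := by
  have h1 : (connectedCount IsTwoRegularRel k : ℝ) * 2 = connectedCount IsPermRel k := by
    exact_mod_cast connectedCount_twoRegular_mul_two hk
  have h2 := connectedCount_perm (show 0 < k by omega)
  rw [← h1] at h2
  rw [mul_div_right_comm] at h2
  linarith

theorem connectedCount_twoRegular_eq_zero {k : ℕ} (hk : k < 3) :
    connectedCount IsTwoRegularRel k = 0 := by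
  have : IsEmpty {r : Fin k → Fin k → Prop //
      IsTwoRegularRel _ r ∧ (SimpleGraph.fromRel r).Connected} := by
    refine ⟨fun r => ?_⟩
    obtain ⟨v⟩ := r.2.2.nonempty
    have h1 := r.2.1.2.2 v
    have h2 : {b | r.1 v b} ⊂ univ := by
      rw [Set.ssubset_univ_iff, Set.ne_univ_iff_exists_notMem]
      exact ⟨v, r.2.1.2.1 v⟩
    have h3 := Set.ncard_lt_ncard h2
    rw [h1, Set.ncard_univ, Nat.card_fin] at h3
    omega
  rw [connectedCount, Nat.card_of_isEmpty]

/-! ### Asymptotics of the number of `2`-regular graphs -/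

/-- The number of `2`-regular graphs on `n` labeled vertices, divided by `n!`. -/
noncomputable def twoRegularWeight (n : ℕ) : ℝ := totalCount IsTwoRegularRel n / n.factorial

theorem twoRegularWeight_nonneg (n : ℕ) : 0 ≤ twoRegularWeight n := by
  unfold twoRegularWeight; positivity

theorem twoRegularWeight_zero : twoRegularWeight 0 = 1 := by
  have : Nat.card {r : Fin 0 → Fin 0 → Prop // IsTwoRegularRel _ r} = 1 := by
    rw [Nat.card_eq_one_iff_unique]
    exact ⟨⟨fun r s => Subtype.ext (funext fun a => a.elim0)⟩,
      ⟨⟨fun a => a.elim0, fun a => a.elim0, fun a => a.elim0, fun a => a.elim0⟩⟩⟩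
  simp [twoRegularWeight, totalCount, this]

theorem twoRegularWeight_sum (m : ℕ) :
    ((m : ℝ) + 2) * twoRegularWeight (m + 2) =
      1 / 2 * ∑ j ∈ Finset.range m, twoRegularWeight j := by
  have h := normalized_recurrence IsTwoRegularRel.isDecomposable (m + 2)
  have h0 : ∀ k : ℕ, k < 3 →
      (k : ℝ) * (connectedCount IsTwoRegularRel k / k.factorial) = 0 := fun k hk => by
    rw [connectedCount_twoRegular_eq_zero hk]; simp
  rw [Finset.sum_range_succ', Finset.sum_range_succ', Finset.sum_range_succ', h0 0 (by omega),
    h0 (0 + 1) (by omega), h0 (0 + 1 + 1) (by omega), zero_mul, zero_mul, zero_mul, add_zero,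
    add_zero, add_zero, Finset.sum_congr rfl fun k _ => by
      rw [connectedCount_twoRegular (show 3 ≤ k + 1 + 1 + 1 by omega)]] at h
  rw [Finset.mul_sum, ← Finset.sum_range_reflect]
  push_cast at h
  rw [twoRegularWeight, h]
  refine Finset.sum_congr rfl fun k hk => ?_
  rw [show m - (k + 1) = m - 1 - k by omega]
  rfl

theorem twoRegularWeight_recurrence (n : ℕ) :
    ((n : ℝ) + 3) * twoRegularWeight (n + 3) =
      (n + 2) * twoRegularWeight (n + 2) + twoRegularWeight n / 2 := by
  have h := twoRegularWeight_sum (n + 1)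
  rw [Finset.sum_range_succ, mul_add, ← twoRegularWeight_sum n] at h
  push_cast at h
  rw [show n + 1 + 2 = n + 3 by ring] at h
  linarith

/-! ### Monotone quantities for the recurrence -/

theorem mul_mono_of_recurrence {p : ℕ → ℝ} (hp : ∀ n, 0 ≤ p n)
    (hrec : ∀ n : ℕ, ((n : ℝ) + 3) * p (n + 3) = (n + 2) * p (n + 2) + p n / 2)
    (n : ℕ) :
    ((n : ℝ) + 2) * p (n + 2) ≤ (n + 3) * p (n + 3) := by
  have := hrec n; have := hp n; linarith

theorem anti_of_recurrence {p : ℕ → ℝ} (hp : ∀ n, 0 ≤ p n)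
    (hrec : ∀ n : ℕ, ((n : ℝ) + 3) * p (n + 3) = (n + 2) * p (n + 2) + p n / 2)
    (n : ℕ) : p (n + 5) ≤ p (n + 4) := by
  have h1 := mul_mono_of_recurrence hp hrec n
  have h2 := mul_mono_of_recurrence hp hrec (n + 1)
  have h3 := hrec (n + 2)
  push_cast at h2 h3
  rw [show n + 1 + 2 = n + 3 by ring, show n + 1 + 3 = n + 4 by ring] at h2
  rw [show n + 2 + 3 = n + 5 by ring, show n + 2 + 2 = n + 4 by ring] at h3
  have hn : (0 : ℝ) ≤ n := by positivity
  have h4 := hp (n + 4)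
  -- Monotonicity of m p_m and n + 4 ≤ 2(n + 2).
  have h5 : p (n + 2) ≤ 2 * p (n + 4) := by
    by_contra! hlt
    nlinarith
  nlinarith

theorem pos_of_recurrence {p : ℕ → ℝ} (hp : ∀ n, 0 ≤ p n)
    (hrec : ∀ n : ℕ, ((n : ℝ) + 3) * p (n + 3) = (n + 2) * p (n + 2) + p n / 2)
    (h0 : 0 < p 0) (n : ℕ) : 0 < p (n + 3) := by
  have h : 0 < ((n : ℝ) + 3) * p (n + 3) := by
    induction n with
    | zero =>
      have := hrec 0; have := hp 2
      norm_num at *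
      linarith
    | succ n ih =>
      have := mul_mono_of_recurrence hp hrec (n + 1)
      push_cast at this ⊢
      rw [show n + 1 + 2 = n + 3 by ring] at this
      linarith
  exact pos_of_mul_pos_right h (by positivity)

/-- With N = n + 13, the recurrence and p_N ≤ p_{N-2} give 2(N+1) p_{N+1} ≥ (2N+1) p_N. Square and
use (2N+1)² ≥ 4N(N+1). -/
theorem lower_step_of_recurrence {p : ℕ → ℝ} (hp : ∀ n, 0 ≤ p n)
    (hrec : ∀ n : ℕ, ((n : ℝ) + 3) * p (n + 3) = (n + 2) * p (n + 2) + p n / 2)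
    (n : ℕ) :
    ((n : ℝ) + 13) * p (n + 13) ^ 2 ≤ (n + 14) * p (n + 14) ^ 2 := by
  have h3 := hrec (n + 11)
  push_cast at h3
  rw [show n + 11 + 3 = n + 14 by ring, show n + 11 + 2 = n + 13 by ring] at h3
  have h4 : p (n + 13) ≤ p (n + 11) :=
    (anti_of_recurrence hp hrec (n + 8)).trans (anti_of_recurrence hp hrec (n + 7))
  have hp13 := hp (n + 13)
  have hp14 := hp (n + 14)
  have hn : (0 : ℝ) ≤ n := by positivity
  generalize p (n + 13) = b at *
  generalize p (n + 14) = a at *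
  have h5 : (2 * (n : ℝ) + 27) * b ≤ 2 * (n + 14) * a := by linarith
  have h6 : ((2 * (n : ℝ) + 27) * b) ^ 2 ≤ (2 * (n + 14) * a) ^ 2 := by gcongr
  have h7 : 4 * ((n : ℝ) + 14) * ((n + 13) * b ^ 2) ≤ 4 * (n + 14) * ((n + 14) * a ^ 2) := by
    nlinarith [sq_nonneg b]
  exact le_of_mul_le_mul_left h7 (by positivity)

/-- Makes (N + 4) p_N² nonincreasing from N = 13, which bounds the nondecreasing N p_N². The shift 4
gives enough room for the polynomial inequality `hpoly`. -/
theorem upper_step_of_recurrence {p : ℕ → ℝ} (hp : ∀ n, 0 ≤ p n)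
    (hrec : ∀ n : ℕ, ((n : ℝ) + 3) * p (n + 3) = (n + 2) * p (n + 2) + p n / 2)
    (n : ℕ) :
    ((n : ℝ) + 18) * p (n + 14) ^ 2 ≤ (n + 17) * p (n + 13) ^ 2 := by
  have h3 := hrec (n + 11)
  have h1 := mul_mono_of_recurrence hp hrec (n + 9)
  have h2 := mul_mono_of_recurrence hp hrec (n + 10)
  push_cast at h1 h2 h3
  rw [show n + 11 + 3 = n + 14 by ring, show n + 11 + 2 = n + 13 by ring] at h3
  rw [show n + 9 + 3 = n + 12 by ring, show n + 9 + 2 = n + 11 by ring] at h1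
  rw [show n + 10 + 3 = n + 13 by ring, show n + 10 + 2 = n + 12 by ring] at h2
  have hp13 := hp (n + 13)
  have hp14 := hp (n + 14)
  have hn : (0 : ℝ) ≤ n := by positivity
  have h4 : ((n : ℝ) + 11) * p (n + 11) ≤ (n + 13) * p (n + 13) := by linarith
  generalize p (n + 13) = b at *
  generalize p (n + 14) = a at *
  generalize p (n + 11) = c at *
  have h5 : 2 * ((n : ℝ) + 14) * (n + 11) * a ≤ (2 * n + 23) * (n + 13) * b := by nlinarith
  have h6 : (2 * ((n : ℝ) + 14) * (n + 11) * a) ^ 2 ≤ ((2 * n + 23) * (n + 13) * b) ^ 2 := by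
    gcongr
  have hpoly : ((n : ℝ) + 18) * ((2 * n + 23) * (n + 13)) ^ 2 ≤
      (n + 17) * (2 * (n + 14) * (n + 11)) ^ 2 := by
    have : 0 ≤ (n : ℝ) ^ 3 := by positivity
    have : 0 ≤ (n : ℝ) ^ 2 := by positivity
    nlinarith
  have h7 : (2 * ((n : ℝ) + 14) * (n + 11)) ^ 2 * ((n + 18) * a ^ 2) ≤
      (2 * ((n : ℝ) + 14) * (n + 11)) ^ 2 * ((n + 17) * b ^ 2) := by
    calc (2 * ((n : ℝ) + 14) * (n + 11)) ^ 2 * ((n + 18) * a ^ 2)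
        = (n + 18) * (2 * ((n : ℝ) + 14) * (n + 11) * a) ^ 2 := by ring
      _ ≤ (n + 18) * ((2 * n + 23) * (n + 13) * b) ^ 2 := by gcongr
      _ = ((n + 18) * ((2 * n + 23) * (n + 13)) ^ 2) * b ^ 2 := by ring
      _ ≤ ((n + 17) * (2 * (n + 14) * (n + 11)) ^ 2) * b ^ 2 := by gcongr
      _ = (2 * ((n : ℝ) + 14) * (n + 11)) ^ 2 * ((n + 17) * b ^ 2) := by ring
  exact le_of_mul_le_mul_left h7 (by positivity)

theorem exists_tendsto_mul_sqrt_of_recurrence {p : ℕ → ℝ} (hp : ∀ n, 0 ≤ p n)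
    (hrec : ∀ n : ℕ, ((n : ℝ) + 3) * p (n + 3) = (n + 2) * p (n + 2) + p n / 2)
    (h0 : 0 < p 0) :
    ∃ A, 0 < A ∧ Tendsto (fun n : ℕ => p n * √(n : ℝ)) atTop (𝓝 A) := by
  set y : ℕ → ℝ := fun n => ((n : ℝ) + 13) * p (n + 13) ^ 2 with hy
  have hmono : Monotone y := monotone_nat_of_le_succ fun n => by
    have := lower_step_of_recurrence hp hrec n
    simp only [hy]
    push_cast
    rw [show n + 1 + 13 = n + 14 by ring, add_assoc (n : ℝ) 1 13]
    norm_num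
    exact this
  have hanti : Antitone fun n : ℕ => ((n : ℝ) + 17) * p (n + 13) ^ 2 :=
    antitone_nat_of_succ_le fun n => by
      have := upper_step_of_recurrence hp hrec n
      push_cast
      rw [show n + 1 + 13 = n + 14 by ring, add_assoc (n : ℝ) 1 17]
      norm_num
      exact this
  have hbdd : BddAbove (range y) := by
    refine ⟨17 * p 13 ^ 2, ?_⟩
    rintro _ ⟨n, rfl⟩
    have h1 := hanti (Nat.zero_le n)
    simp only [Nat.cast_zero, zero_add] at h1
    refine le_trans ?_ h1
    simp only [hy]
    gcongr
    norm_num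
  have hlim := tendsto_atTop_ciSup hmono hbdd
  set B := ⨆ n, y n with hB
  have hB0 : 0 < B := by
    refine lt_of_lt_of_le ?_ (le_ciSup hbdd 0)
    have := pos_of_recurrence hp hrec h0 10
    simp only [hy]
    positivity
  refine ⟨√B, Real.sqrt_pos.2 hB0, ?_⟩
  rw [← tendsto_add_atTop_iff_nat 13]
  refine hlim.sqrt.congr fun n => ?_
  simp only [hy]
  rw [Real.sqrt_mul (by positivity), Real.sqrt_sq (hp _), mul_comm]
  push_cast
  rfl

/-! ### Transfer to `TwoRegularGraph` -/

theorem isRegularOfDegree_iff {V : Type} [Finite V] (G : SimpleGraph V) [G.LocallyFinite] :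
    G.IsRegularOfDegree 2 ↔ IsTwoRegular G := by
  refine forall_congr' fun v => ?_
  rw [← SimpleGraph.card_neighborSet_eq_degree, ← Nat.card_eq_fintype_card, Nat.card_coe_set_eq]

/-- A `2`-regular graph on `n` labeled vertices as a relation. -/
noncomputable def twoRegularGraphEquiv (n : ℕ) :
    TwoRegularGraph n ≃ {r : Fin n → Fin n → Prop // IsTwoRegularRel _ r} :=
  (Equiv.subtypeEquivRight fun G => by
    classical exact isRegularOfDegree_iff G).trans (twoRegularEquiv (Fin n))

instance finite_twoRegularGraph (n : ℕ) : Finite (TwoRegularGraph n) :=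
  Finite.of_equiv _ (twoRegularGraphEquiv n).symm

theorem nonempty_twoRegularGraph {n : ℕ} (hn : 3 ≤ n) : Nonempty (TwoRegularGraph n) := by
  classical
  obtain ⟨m, rfl⟩ : ∃ m, n = m + 3 := ⟨n - 3, by omega⟩
  refine ⟨⟨SimpleGraph.cycleGraph (m + 3), ?_⟩⟩
  -- The round trip only replaces the `LocallyFinite` instance.
  rw [isRegularOfDegree_iff, ← isRegularOfDegree_iff]
  exact fun v => SimpleGraph.cycleGraph_degree_three_le

theorem tendsto_twoRegular_largest {x : ℝ} (hx : x ∈ Icc (1 / 2 : ℝ) 1) :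
    Tendsto (fun n : ℕ => uniformProb (fun G : TwoRegularGraph n =>
        x * (n : ℝ) < (TwoRegularGraph.largest G : ℝ))) atTop
      (𝓝 (∫ y in x..1, 1 / (2 * y * Real.sqrt (1 - y)))) := by
  obtain ⟨A, hA, hp⟩ := exists_tendsto_mul_sqrt_of_recurrence twoRegularWeight_nonneg
    twoRegularWeight_recurrence (by rw [twoRegularWeight_zero]; exact one_pos)
  have hq : Tendsto (fun k : ℕ =>
      (k : ℝ) * (connectedCount IsTwoRegularRel k / (k.factorial * 1 ^ k) : ℝ)) atTop
      (𝓝 (1 / 2)) := by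
    refine tendsto_const_nhds.congr' ?_
    filter_upwards [eventually_ge_atTop 3] with k hk
    rw [one_pow, mul_one, connectedCount_twoRegular hk]
  have h := tendsto_uniformProb_largestComponent IsTwoRegularRel.isDecomposable one_pos hA
    (by simpa only [one_pow, mul_one, twoRegularWeight] using hp) hq hx
  refine h.congr fun n => (uniformProb_congr (twoRegularGraphEquiv n) fun G => ?_).symm
  change _ ↔ x * n < (largestComponent (SimpleGraph.fromRel G.1.Adj) : ℝ)
  rw [fromRel_adj_self]
  rfl

end RandomStructures

theorem mainTheorem2 :
    -- random mappings: medians exist, every choice of medians has the stated limit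
    ((∀ n : ℕ, 1 ≤ n →
        ∃ m : ℝ, RandomStructures.IsMedian
          (fun f : RandomStructures.Mapping n => RandomStructures.Mapping.largest f) m) ∧
      (∀ ν : ℕ → ℝ,
        (∀ᶠ n : ℕ in Filter.atTop, RandomStructures.IsMedian
          (fun f : RandomStructures.Mapping n => RandomStructures.Mapping.largest f) (ν n)) →
        Filter.Tendsto (fun n : ℕ => ν n / (n : ℝ)) Filter.atTop
          (nhds (4 * Real.exp 1 / (1 + Real.exp 1) ^ 2))) ∧
      (∀ x : ℝ, x ∈ Set.Icc (1 / 2 : ℝ) 1 →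
        Filter.Tendsto
          (fun n : ℕ => RandomStructures.uniformProb
            (fun f : RandomStructures.Mapping n =>
              x * (n : ℝ) < (RandomStructures.Mapping.largest f : ℝ)))
          Filter.atTop (nhds (∫ y in x..1, 1 / (2 * y * Real.sqrt (1 - y)))))) ∧
    -- random 2-regular labeled graphs, which exist for `3 ≤ n`
    ((∀ n : ℕ, 3 ≤ n →
        ∃ m : ℝ, RandomStructures.IsMedian
          (fun G : RandomStructures.TwoRegularGraph n =>
            RandomStructures.TwoRegularGraph.largest G) m) ∧
      (∀ ν : ℕ → ℝ,
        (∀ᶠ n : ℕ in Filter.atTop, RandomStructures.IsMedian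
          (fun G : RandomStructures.TwoRegularGraph n =>
            RandomStructures.TwoRegularGraph.largest G) (ν n)) →
        Filter.Tendsto (fun n : ℕ => ν n / (n : ℝ)) Filter.atTop
          (nhds (4 * Real.exp 1 / (1 + Real.exp 1) ^ 2))) ∧
      (∀ x : ℝ, x ∈ Set.Icc (1 / 2 : ℝ) 1 →
        Filter.Tendsto
          (fun n : ℕ => RandomStructures.uniformProb
            (fun G : RandomStructures.TwoRegularGraph n =>
              x * (n : ℝ) < (RandomStructures.TwoRegularGraph.largest G : ℝ)))
          Filter.atTop (nhds (∫ y in x..1, 1 / (2 * y * Real.sqrt (1 - y)))))) ∧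
    -- the decimal value of the limit
    (0.78644773296592741014 ≤ 4 * Real.exp 1 / (1 + Real.exp 1) ^ 2 ∧
      4 * Real.exp 1 / (1 + Real.exp 1) ^ 2 < 0.78644773296592741015) := by
  refine ⟨⟨fun n hn => ?_, ?_, fun x hx => ?_⟩, ⟨fun n hn => ?_, ?_, fun x hx => ?_⟩, ?_⟩
  · have : Nonempty (Fin n) := ⟨⟨0, hn⟩⟩
    exact RandomStructures.exists_isMedian _
  · exact RandomStructures.tendsto_median _ fun x hx => RandomStructures.tendsto_mapping_largest hx
  · exact RandomStructures.tendsto_mapping_largest hx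
  · have := RandomStructures.nonempty_twoRegularGraph hn
    exact RandomStructures.exists_isMedian _
  · exact RandomStructures.tendsto_median _ fun x hx =>
      RandomStructures.tendsto_twoRegular_largest hx
  · exact RandomStructures.tendsto_twoRegular_largest hx
  · exact RandomStructures.limit_constant_bounds
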